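/- Let $M$ be a (nonempty) smooth manifold of dimension $n\ge 2$, and let $F=\alpha^2/\beta$ be a non-Riemannian Kropina metric on $M$: here $\alpha=\sqrt{a_{ij}(x)y^iy^j}$ is (the norm of) a smooth Riemannian metric, $\beta=b_i(x)y^i$ is a smooth $1$-form without zeros, $F$ is considered on the cone of tangent vectors $y\in T_xM$ with $\beta(y)>0$, and non-Riemannian means that there is no smooth Riemannian metric on $M$ whose squared norm agrees with $F^2$ on this cone. Let $(h,W)$ be the navigation data of $F$, that is, $h$ is a smooth Riemannian metric and $W$ a smooth vector field on $M$ with $\|W\|_h=1$ such that $$\left\|\frac{y}{F(x,y)}-W_x\right\|_h=1\qquad\text{for all } x\in M,\ y\in T_xM \text{ with } \beta(y)>0 .$$ Put $g_{ij}=\tfrac12[F^2]_{y^iy^j}$, $G^i=\tfrac14 g^{il}\{[F^2]_{x^ky^l}y^k-[F^2]_{x^l}\}$ and $$R^i{}_k=2\frac{\partial G^i}{\partial x^k}-\frac{\partial^2G^i}{\partial x^m\partial y^k}y^m+2G^m\frac{\partial^2G^i}{\partial y^m\partial y^k}-\frac{\partial G^i}{\partial y^m}\frac{\partial G^m}{\partial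 y^k},$$ and say that $F$ has constant flag curvature $K\in\mathbb R$ if $R^i{}_k=K\,(F^2\delta^i_k-g_{kj}y^jy^i)$ in all local coordinates, at all $(x,y)$ with $\beta(y)>0$. Then, for every $K\in\mathbb R$, $F$ has constant flag curvature $K$ if and only if both of the following conditions hold: 1. $W$ is a unit Killing vector field of $h$, i.e. $\|W\|_h=1$ and $W_{i;j}+W_{j;i}=0$, where $W_i=h_{ij}W^j$ and ";" is the covariant derivative of the Levi-Civita connection of $h$; 2. $K\ge 0$ and $(M,h)$ has constant sectional curvature $K$. -/

import Mathlib

open scoped Manifold ContDiff Bundle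

noncomputable section

namespace Finsler

/-- The model space of the coordinates. -/
abbrev Rn (n : ℕ) := EuclideanSpace ℝ (Fin n)

/-! ### Partial derivatives and Finsler curvature in coordinates

A Finsler function is handled through `L = F ^ 2`, written in induced coordinates `(x, y)` of the
tangent bundle; it only has to be meaningful on an open conic set of pairs `(x, y)`. -/

section Coordinates

variable {n : ℕ}

/-- The `i`-th coordinate vector of `ℝⁿ`. -/
def coordVec (i : Fin n) : Rn n := EuclideanSpace.single i 1

/-- The partial derivative `∂f/∂x^k`. -/
def pderiv (k : Fin n) (f : Rn n → ℝ) (x : Rn n) : ℝ := fderiv ℝ f x (coordVec k)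

/-- The partial derivative `∂L/∂x^k` of a function of `(x, y)`. -/
def partialX (k : Fin n) (L : Rn n → Rn n → ℝ) (x y : Rn n) : ℝ := pderiv k (fun x' => L x' y) x

/-- The partial derivative `∂L/∂y^k` of a function of `(x, y)`. -/
def partialY (k : Fin n) (L : Rn n → Rn n → ℝ) (x y : Rn n) : ℝ := pderiv k (fun y' => L x y') y

/-- The fundamental tensor `g_{ij} = ½ [F²]_{y^i y^j}`, where `L = F²`. -/
def fundamentalTensor (L : Rn n → Rn n → ℝ) (x y : Rn n) : Matrix (Fin n) (Fin n) ℝ :=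
  Matrix.of fun i j => (1 / 2 : ℝ) * partialY i (partialY j L) x y

/-- The geodesic coefficients `G^i = ¼ g^{il} ([F²]_{x^k y^l} y^k - [F²]_{x^l})`, where `L = F²`. -/
def geodesicCoeff (L : Rn n → Rn n → ℝ) (i : Fin n) (x y : Rn n) : ℝ :=
  (1 / 4 : ℝ) * ∑ l, (fundamentalTensor L x y)⁻¹ i l *
    ((∑ k, partialX k (partialY l L) x y * y k) - partialX l L x y)

/-- The Riemann curvature of a Finsler metric,
`R^i_k = 2 ∂G^i/∂x^k - y^m ∂²G^i/∂x^m∂y^k + 2 G^m ∂²G^i/∂y^m∂y^k - ∂G^i/∂y^m ∂G^m/∂y^k`,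
where `L = F²`. -/
def riemannCurvature (L : Rn n → Rn n → ℝ) (i k : Fin n) (x y : Rn n) : ℝ :=
  2 * partialX k (geodesicCoeff L i) x y
    - ∑ m, y m * partialX m (partialY k (geodesicCoeff L i)) x y
    + 2 * ∑ m, geodesicCoeff L m x y * partialY m (partialY k (geodesicCoeff L i)) x y
    - ∑ m, partialY m (geodesicCoeff L i) x y * partialY k (geodesicCoeff L m) x y

/-- The Christoffel symbols
`Γ^i_{jk} = ½ g^{il} (∂_j g_{lk} + ∂_k g_{lj} - ∂_l g_{jk})` of a metric with coefficients `g`. -/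
def christoffel (g : Rn n → Matrix (Fin n) (Fin n) ℝ) (i j k : Fin n) (x : Rn n) : ℝ :=
  (1 / 2 : ℝ) * ∑ l, (g x)⁻¹ i l *
    (pderiv j (fun x' => g x' l k) x + pderiv k (fun x' => g x' l j) x
      - pderiv l (fun x' => g x' j k) x)

/-- The components `R^i_{jkl}` of the curvature tensor of a metric with coefficients `g`, where
`R(∂_k, ∂_l) ∂_j = ∇_k ∇_l ∂_j - ∇_l ∇_k ∂_j = R^i_{jkl} ∂_i`. -/
def curvatureTensor (g : Rn n → Matrix (Fin n) (Fin n) ℝ) (i j k l : Fin n) (x : Rn n) : ℝ :=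
  pderiv k (christoffel g i l j) x - pderiv l (christoffel g i k j) x
    + ∑ m, (christoffel g i k m x * christoffel g m l j x
      - christoffel g i l m x * christoffel g m k j x)

/-- The inner product `g_{ij} v^i w^j` at `x`. -/
def coordInner (g : Rn n → Matrix (Fin n) (Fin n) ℝ) (x v w : Rn n) : ℝ :=
  ∑ i, ∑ j, g x i j * v i * w j

/-- The sectional curvature `⟨R(v, w) w, v⟩ / (|v|² |w|² - ⟨v, w⟩²)` of the plane spanned by the
linearly independent vectors `v` and `w` at `x`. -/
def sectionalCurvature (g : Rn n → Matrix (Fin n) (Fin n) ℝ) (x v w : Rn n) : ℝ :=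
  (∑ i, ∑ j, ∑ k, ∑ l, (∑ p, g x i p * curvatureTensor g p j k l x) * v i * w j * v k * w l) /
    (coordInner g x v v * coordInner g x w w - coordInner g x v w ^ 2)

/-- The covariant derivative `W_{i;j} = ∂_j W_i - Γ^k_{ij} W_k` of a covector field. -/
def covDeriv (g : Rn n → Matrix (Fin n) (Fin n) ℝ) (w : Fin n → Rn n → ℝ) (i j : Fin n)
    (x : Rn n) : ℝ :=
  pderiv j (w i) x - ∑ k, christoffel g k i j x * w k x

end Coordinates

/-! ### Objects on a manifold -/

section Manifold

variable (n : ℕ) (M : Type*) [TopologicalSpace M] [ChartedSpace (EuclideanSpace ℝ (Fin n)) M]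
  [IsManifold (𝓡 n) ∞ M]

/-- Smooth Riemannian metrics on `M`. -/
abbrev RiemMetric := Bundle.ContMDiffRiemannianMetric (𝓡 n) ∞ (Rn n)
  (fun x : M => TangentSpace (𝓡 n) x)

/-- Smooth vector fields on `M`. -/
abbrev SmoothVectorField := ContMDiffSection (𝓡 n) (Rn n) ∞ (fun x : M => TangentSpace (𝓡 n) x)

/-- A Kropina metric `F = α² / β` on `M`: a smooth Riemannian metric `α` together with a smooth
`1`-form `β` without zeros. -/
structure KropinaMetric where
  /-- The Riemannian metric, `α x y y = a_{ij}(x) y^i y^j` being the square of the norm. -/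
  α : RiemMetric n M
  /-- The `1`-form. -/
  β (x : M) : TangentSpace (𝓡 n) x →L[ℝ] ℝ
  contMDiff_β : ContMDiff (𝓡 n) ((𝓡 n).prod 𝓘(ℝ, Rn n →L[ℝ] ℝ)) ∞
    (fun x => Bundle.TotalSpace.mk' (Rn n →L[ℝ] ℝ) x (β x))
  β_ne_zero (x : M) : β x ≠ 0

variable {n M}

/-- The length `‖v‖_h` of a tangent vector. -/
def RiemMetric.length (h : RiemMetric n M) (x : M) (v : TangentSpace (𝓡 n) x) : ℝ :=
  √(h.inner x v v)

namespace KropinaMetric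

/-- The cone of tangent vectors on which the Kropina metric is defined: `β > 0`. -/
def domain (F : KropinaMetric n M) (x : M) : Set (TangentSpace (𝓡 n) x) := {y | 0 < F.β x y}

/-- The Finsler function `F = α² / β`; it is only used on `F.domain`. -/
def toFun (F : KropinaMetric n M) (x : M) (y : TangentSpace (𝓡 n) x) : ℝ :=
  F.α.inner x y y / F.β x y

/-- `F` is Riemannian if `F²` is, on the domain of `F`, the quadratic form of a Riemannian
metric. -/
def IsRiemannian (F : KropinaMetric n M) : Prop :=
  ∃ g : RiemMetric n M, ∀ x, ∀ y ∈ F.domain x, F.toFun x y ^ 2 = g.inner x y y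

end KropinaMetric

/-- The navigation data of `F`: the wind `W` has `h`-length one, and `F` solves the navigation
problem `‖y / F - W‖_h = 1`. -/
structure IsNavigationData (F : KropinaMetric n M) (h : RiemMetric n M)
    (W : SmoothVectorField n M) : Prop where
  unit (x : M) : RiemMetric.length h x (W x) = 1
  solves (x : M) (y : TangentSpace (𝓡 n) x) (hy : y ∈ F.domain x) :
    RiemMetric.length h x ((F.toFun x y)⁻¹ • y - W x) = 1

/-! ### Coordinate expressions -/

/-- For a chart `e` of `M` and a point `u` of `ℝⁿ` in its image, the map sending `y : ℝⁿ` to the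
tangent vector `y^i ∂/∂x^i` at the point with coordinates `u`. -/
def frame (e : OpenPartialHomeomorph M (Rn n)) (u : Rn n) :
    Rn n →L[ℝ] TangentSpace (𝓡 n) (e.symm u) :=
  mfderiv (𝓡 n) (𝓡 n) e.symm u

/-- The coefficients `h_{ij}` of a Riemannian metric in the chart `e`. -/
def metricCoeff (h : RiemMetric n M) (e : OpenPartialHomeomorph M (Rn n)) (u : Rn n) :
    Matrix (Fin n) (Fin n) ℝ :=
  Matrix.of fun i j => h.inner (e.symm u) (frame e u (coordVec i)) (frame e u (coordVec j))

/-- The covariant components `W_i = h_{ij} W^j` of a vector field in the chart `e`. -/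
def lowerCoeff (h : RiemMetric n M) (W : SmoothVectorField n M)
    (e : OpenPartialHomeomorph M (Rn n)) (i : Fin n) (u : Rn n) : ℝ :=
  h.inner (e.symm u) (W (e.symm u)) (frame e u (coordVec i))

/-- The function `F²` of a Kropina metric in the induced coordinates `(x, y)` of the chart `e`. -/
def KropinaMetric.sqCoord (F : KropinaMetric n M) (e : OpenPartialHomeomorph M (Rn n))
    (x y : Rn n) : ℝ :=
  F.toFun (e.symm x) (frame e x y) ^ 2

/-! ### The notions of the theorem -/

/-- `F` is of constant flag curvature `K`: in every smooth chart of `M` and at every point and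
direction in the domain of `F`, `R^i_k = K (F² δ^i_k - g_{kj} y^j y^i)`. -/
def HasConstantFlagCurvature (F : KropinaMetric n M) (K : ℝ) : Prop :=
  ∀ e ∈ IsManifold.maximalAtlas (𝓡 n) ∞ M, ∀ x ∈ e.target, ∀ y : Rn n,
    frame e x y ∈ F.domain (e.symm x) → ∀ i k : Fin n,
      riemannCurvature (F.sqCoord e) i k x y =
        K * (F.sqCoord e x y * (if i = k then 1 else 0)
          - (∑ j, fundamentalTensor (F.sqCoord e) x y k j * y j) * y i)

/-- `W` is a unit Killing vector field of `h`: `‖W‖_h = 1`, and `W_{i;j} + W_{j;i} = 0` in every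
smooth chart. -/
def IsUnitKilling (h : RiemMetric n M) (W : SmoothVectorField n M) : Prop :=
  (∀ x, RiemMetric.length h x (W x) = 1) ∧
    ∀ e ∈ IsManifold.maximalAtlas (𝓡 n) ∞ M, ∀ x ∈ e.target, ∀ i j : Fin n,
      covDeriv (metricCoeff h e) (lowerCoeff h W e) i j x
        + covDeriv (metricCoeff h e) (lowerCoeff h W e) j i x = 0

/-- All sectional curvatures of `h` are equal to `K`. -/
def HasConstantSectionalCurvature (h : RiemMetric n M) (K : ℝ) : Prop :=
  ∀ e ∈ IsManifold.maximalAtlas (𝓡 n) ∞ M, ∀ x ∈ e.target, ∀ v w : Rn n,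
    LinearIndependent ℝ ![v, w] → sectionalCurvature (metricCoeff h e) x v w = K

end Manifold

end Finsler

end

open scoped Manifold ContDiff Bundle

set_option maxSynthPendingDepth 3
set_option linter.unusedSectionVars false

noncomputable section

namespace Finsler

/-! ### Partial derivatives of functions of `(x, y)` -/

section PartialDerivatives

/-! Write `⟨·,·⟩` for the metric `h`. Expanding `‖y/F - W‖ = 1` with `‖W‖ = 1` gives `F = ⟨y,y⟩ /
(2⟨W,y⟩)`, and the cone `β > 0` turns out to be `⟨W,y⟩ > 0` (`mem_domain_iff`). The theorem
therefore concerns only a metric and a unit field on an open set of a vector space; the sections on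
index notation and charts carry out this translation.

The spray of `F` is `G + P y` (`kro_spray_eq`), where `G` is polynomial in `y` and `1/⟨W,y⟩`, while
`P = -⟨∇_y W,y⟩⟨W,y⟩ / ⟨y,y⟩` carries the only denominator `⟨y,y⟩`.

Constant flag curvature forces `W` to be Killing (`killing_of_constant_curvature`). Modulo multiples
of `y`, a projective change adds `P² + 2 dP(G) - ∂P(y)` times the identity to the curvature
(`sprayCurvature_projective`), where `∂P` is the derivative in `x`. After multiplication by `⟨y,y⟩²`
this is `3 (⟨∇_y W,y⟩⟨W,y⟩)²` plus a multiple of `⟨y,y⟩`, and the rest of the equation is a multiple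
of `⟨y,y⟩` too. On a line `y = u + t W` with `u` a unit vector orthogonal to `W` one has `⟨y,y⟩ = 1
+ t²`, and the complex root `t = i` forces `⟨∇_y W,y⟩` to vanish on the line.

If `W` is Killing, Kostant's formula `∇²W = -R(W,·)·` reduces the curvature to `η ↦ R(η - dF(η) W,
ξ) ξ` with `ξ = y - F W` and `|ξ| = F` (`sprayCurvature_killingSpray`). The flag curvature condition
becomes the constant curvature identity for `h` at `ξ`, and up to sign every nonzero vector occurs
as some `ξ` (`riem_of_sprayCurvature`). Finally `|∇_v W|² = K |v|²` for `v` orthogonal to `W` gives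
`K ≥ 0` (`curvature_nonneg`). -/

lemma two_le_infty : (2 : WithTop ℕ∞) ≤ ∞ :=
  WithTop.coe_le_coe.2 (le_top : (2 : ℕ∞) ≤ ⊤)

lemma one_add_one_le_infty : (1 + 1 : WithTop ℕ∞) ≤ ∞ := by
  rw [one_add_one_eq_two]; exact two_le_infty

variable {E V : Type*} [NormedAddCommGroup E] [NormedSpace ℝ E]
  [NormedAddCommGroup V] [NormedSpace ℝ V]

/-- The derivative of `f (x, y)` in `x`, in the direction `v`. -/
def dX (v : E) (f : E → E → V) (x y : E) : V := fderiv ℝ (fun x' => f x' y) x v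

/-- The derivative of `f (x, y)` in `y`, in the direction `v`. -/
def dY (v : E) (f : E → E → V) (x y : E) : V := fderiv ℝ (fun y' => f x y') y v

/-- Smoothness of a function of two variables on a set of pairs. -/
def SmoothPair (Ω : Set (E × E)) (f : E → E → V) : Prop :=
  ContDiffOn ℝ ∞ (fun p : E × E => f p.1 p.2) Ω

variable {Ω : Set (E × E)} {f g : E → E → V} {x y : E}

lemma SmoothPair.contDiffAt (hΩ : IsOpen Ω) (hf : SmoothPair Ω f) (h : (x, y) ∈ Ω) :
    ContDiffAt ℝ ∞ (fun p : E × E => f p.1 p.2) (x, y) :=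
  ContDiffOn.contDiffAt hf (hΩ.mem_nhds h)

lemma SmoothPair.differentiableAt (hΩ : IsOpen Ω) (hf : SmoothPair Ω f) (h : (x, y) ∈ Ω) :
    DifferentiableAt ℝ (fun p : E × E => f p.1 p.2) (x, y) :=
  (hf.contDiffAt hΩ h).differentiableAt (by simp)

lemma SmoothPair.hasFDerivAt_left (hΩ : IsOpen Ω) (hf : SmoothPair Ω f) (h : (x, y) ∈ Ω) :
    HasFDerivAt (fun x' => f x' y)
      ((fderiv ℝ (fun p : E × E => f p.1 p.2) (x, y)).comp (ContinuousLinearMap.inl ℝ E E)) x :=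
  HasFDerivAt.comp (g := fun p : E × E => f p.1 p.2) (f := fun x' => (x', y)) x (hf.differentiableAt hΩ h).hasFDerivAt
    (hasFDerivAt_prodMk_left x y)

lemma SmoothPair.hasFDerivAt_right (hΩ : IsOpen Ω) (hf : SmoothPair Ω f) (h : (x, y) ∈ Ω) :
    HasFDerivAt (fun y' => f x y')
      ((fderiv ℝ (fun p : E × E => f p.1 p.2) (x, y)).comp (ContinuousLinearMap.inr ℝ E E)) y :=
  HasFDerivAt.comp (g := fun p : E × E => f p.1 p.2) (f := fun y' => (x, y')) y (hf.differentiableAt hΩ h).hasFDerivAt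
    (hasFDerivAt_prodMk_right x y)

lemma SmoothPair.differentiableAt_left (hΩ : IsOpen Ω) (hf : SmoothPair Ω f) (h : (x, y) ∈ Ω) :
    DifferentiableAt ℝ (fun x' => f x' y) x := (hf.hasFDerivAt_left hΩ h).differentiableAt

lemma SmoothPair.differentiableAt_right (hΩ : IsOpen Ω) (hf : SmoothPair Ω f) (h : (x, y) ∈ Ω) :
    DifferentiableAt ℝ (fun y' => f x y') y := (hf.hasFDerivAt_right hΩ h).differentiableAt

lemma dX_eq_fderiv (hΩ : IsOpen Ω) (hf : SmoothPair Ω f) (h : (x, y) ∈ Ω) (v : E) :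
    dX v f x y = fderiv ℝ (fun p : E × E => f p.1 p.2) (x, y) (v, 0) := by
  rw [dX, (hf.hasFDerivAt_left hΩ h).fderiv]; simp

lemma dY_eq_fderiv (hΩ : IsOpen Ω) (hf : SmoothPair Ω f) (h : (x, y) ∈ Ω) (v : E) :
    dY v f x y = fderiv ℝ (fun p : E × E => f p.1 p.2) (x, y) (0, v) := by
  rw [dY, (hf.hasFDerivAt_right hΩ h).fderiv]; simp

lemma SmoothPair.congr (hf : SmoothPair Ω f) (h : ∀ x y, (x, y) ∈ Ω → g x y = f x y) :
    SmoothPair Ω g :=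
  ContDiffOn.congr hf fun p hp => h p.1 p.2 hp

lemma SmoothPair.fderiv_apply (hΩ : IsOpen Ω) (hf : SmoothPair Ω f) (v : E × E) :
    ContDiffOn ℝ ∞ (fun p => fderiv ℝ (fun p : E × E => f p.1 p.2) p v) Ω :=
  (ContDiffOn.fderiv_of_isOpen hf hΩ (m := ∞) (by simp)).clm_apply contDiffOn_const

lemma SmoothPair.dX (hΩ : IsOpen Ω) (hf : SmoothPair Ω f) (v : E) : SmoothPair Ω (dX v f) :=
  (hf.fderiv_apply hΩ (v, 0)).congr fun p hp => dX_eq_fderiv hΩ hf (x := p.1) (y := p.2) hp v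

lemma SmoothPair.dY (hΩ : IsOpen Ω) (hf : SmoothPair Ω f) (v : E) : SmoothPair Ω (dY v f) :=
  (hf.fderiv_apply hΩ (0, v)).congr fun p hp => dY_eq_fderiv hΩ hf (x := p.1) (y := p.2) hp v

lemma slice_left_mem {E : Type*} [TopologicalSpace E] {Ω : Set (E × E)} {x y : E} (hΩ : IsOpen Ω) (h : (x, y) ∈ Ω) : ∀ᶠ x' in nhds x, (x', y) ∈ Ω :=
  (by fun_prop : ContinuousAt (fun x' : E => (x', y)) x) (hΩ.mem_nhds h)

lemma slice_right_mem {E : Type*} [TopologicalSpace E] {Ω : Set (E × E)} {x y : E} (hΩ : IsOpen Ω) (h : (x, y) ∈ Ω) : ∀ᶠ y' in nhds y, (x, y') ∈ Ω :=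
  (by fun_prop : ContinuousAt (fun y' : E => (x, y')) y) (hΩ.mem_nhds h)

lemma dX_congr (hΩ : IsOpen Ω) (hfg : ∀ x y, (x, y) ∈ Ω → f x y = g x y) (h : (x, y) ∈ Ω)
    (v : E) : dX v f x y = dX v g x y := by
  have : (fun x' => f x' y) =ᶠ[nhds x] fun x' => g x' y :=
    (slice_left_mem hΩ h).mono fun x' hx' => hfg x' y hx'
  rw [dX, dX, this.fderiv_eq]

lemma dY_congr (hΩ : IsOpen Ω) (hfg : ∀ x y, (x, y) ∈ Ω → f x y = g x y) (h : (x, y) ∈ Ω)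
    (v : E) : dY v f x y = dY v g x y := by
  have : (fun y' => f x y') =ᶠ[nhds y] fun y' => g x y' :=
    (slice_right_mem hΩ h).mono fun y' hy' => hfg x y' hy'
  rw [dY, dY, this.fderiv_eq]

lemma SmoothPair.second_apply (hΩ : IsOpen Ω) (hf : SmoothPair Ω f) (h : (x, y) ∈ Ω)
    (v w : E × E) :
    fderiv ℝ (fun p => fderiv ℝ (fun p : E × E => f p.1 p.2) p v) (x, y) w =
      fderiv ℝ (fun p => fderiv ℝ (fun p : E × E => f p.1 p.2) p w) (x, y) v := by
  have hd : DifferentiableAt ℝ (fderiv ℝ (fun p : E × E => f p.1 p.2)) (x, y) :=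
    ((hf.contDiffAt hΩ h).fderiv_right (m := 1) one_add_one_le_infty).differentiableAt
      (by simp)
  have hs : IsSymmSndFDerivAt ℝ (fun p : E × E => f p.1 p.2) (x, y) :=
    (hf.contDiffAt hΩ h).isSymmSndFDerivAt (by simpa using two_le_infty)
  have key (v : E × E) : fderiv ℝ (fun p => fderiv ℝ (fun p : E × E => f p.1 p.2) p v) (x, y) =
      (fderiv ℝ (fderiv ℝ (fun p : E × E => f p.1 p.2)) (x, y)).flip v := by
    refine ContinuousLinearMap.ext fun w => ?_
    rw [fderiv_clm_apply hd (by fun_prop)]; simp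
  rw [key, key]
  exact hs.eq _ _

lemma dX_dY_comm (hΩ : IsOpen Ω) (hf : SmoothPair Ω f) (h : (x, y) ∈ Ω) (v w : E) :
    dX v (dY w f) x y = dY w (dX v f) x y := by
  rw [dX_eq_fderiv hΩ (hf.dY hΩ w) h, dY_eq_fderiv hΩ (hf.dX hΩ v) h]
  have h1 : (fun p : E × E => Finsler.dY w f p.1 p.2) =ᶠ[nhds (x, y)]
      fun p => fderiv ℝ (fun p : E × E => f p.1 p.2) p (0, w) :=
    Filter.eventually_of_mem (hΩ.mem_nhds h) fun p hp => dY_eq_fderiv hΩ hf hp w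
  have h2 : (fun p : E × E => Finsler.dX v f p.1 p.2) =ᶠ[nhds (x, y)]
      fun p => fderiv ℝ (fun p : E × E => f p.1 p.2) p (v, 0) :=
    Filter.eventually_of_mem (hΩ.mem_nhds h) fun p hp => dX_eq_fderiv hΩ hf hp v
  rw [h1.fderiv_eq, h2.fderiv_eq, hf.second_apply hΩ h]

lemma dY_dY_comm (hΩ : IsOpen Ω) (hf : SmoothPair Ω f) (h : (x, y) ∈ Ω) (v w : E) :
    dY v (dY w f) x y = dY w (dY v f) x y := by
  rw [dY_eq_fderiv hΩ (hf.dY hΩ w) h, dY_eq_fderiv hΩ (hf.dY hΩ v) h]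
  have h1 (w : E) : (fun p : E × E => Finsler.dY w f p.1 p.2) =ᶠ[nhds (x, y)]
      fun p => fderiv ℝ (fun p : E × E => f p.1 p.2) p (0, w) :=
    Filter.eventually_of_mem (hΩ.mem_nhds h) fun p hp => dY_eq_fderiv hΩ hf hp w
  rw [(h1 w).fderiv_eq, (h1 v).fderiv_eq, hf.second_apply hΩ h]

lemma dY_add_dir (u v : E) : dY (u + v) f x y = dY u f x y + dY v f x y := by simp [dY]
lemma dX_smul_dir (c : ℝ) (v : E) : dX (c • v) f x y = c • dX v f x y := by simp [dX]
lemma dY_smul_dir (c : ℝ) (v : E) : dY (c • v) f x y = c • dY v f x y := by simp [dY]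
lemma dX_sum_dir {ι : Type*} (s : Finset ι) (v : ι → E) :
    dX (∑ i ∈ s, v i) f x y = ∑ i ∈ s, dX (v i) f x y := by simp [dX]
lemma dY_sum_dir {ι : Type*} (s : Finset ι) (v : ι → E) :
    dY (∑ i ∈ s, v i) f x y = ∑ i ∈ s, dY (v i) f x y := by simp [dY]

lemma dX_add (hΩ : IsOpen Ω) (hf : SmoothPair Ω f) (hg : SmoothPair Ω g) (h : (x, y) ∈ Ω)
    (v : E) : dX v (fun x y => f x y + g x y) x y = dX v f x y + dX v g x y := by
  rw [dX, fderiv_fun_add (hf.differentiableAt_left hΩ h) (hg.differentiableAt_left hΩ h)]; rfl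

lemma dY_add (hΩ : IsOpen Ω) (hf : SmoothPair Ω f) (hg : SmoothPair Ω g) (h : (x, y) ∈ Ω)
    (v : E) : dY v (fun x y => f x y + g x y) x y = dY v f x y + dY v g x y := by
  rw [dY, fderiv_fun_add (hf.differentiableAt_right hΩ h) (hg.differentiableAt_right hΩ h)]; rfl

lemma dX_smul {c : E → E → ℝ} (hΩ : IsOpen Ω) (hc : SmoothPair Ω c) (hg : SmoothPair Ω g)
    (h : (x, y) ∈ Ω) (v : E) :
    dX v (fun x y => c x y • g x y) x y = c x y • dX v g x y + dX v c x y • g x y := by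
  rw [dX, fderiv_fun_smul (hc.differentiableAt_left hΩ h) (hg.differentiableAt_left hΩ h)]; rfl

lemma dY_smul {c : E → E → ℝ} (hΩ : IsOpen Ω) (hc : SmoothPair Ω c) (hg : SmoothPair Ω g)
    (h : (x, y) ∈ Ω) (v : E) :
    dY v (fun x y => c x y • g x y) x y = c x y • dY v g x y + dY v c x y • g x y := by
  rw [dY, fderiv_fun_smul (hc.differentiableAt_right hΩ h) (hg.differentiableAt_right hΩ h)]; rfl

lemma dX_eq_of_hasDerivAt (hΩ : IsOpen Ω) (hf : SmoothPair Ω f) (h : (x, y) ∈ Ω) {v : E} {d : V}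
    (hd : HasDerivAt (fun t : ℝ => f (x + t • v) y) d 0) : dX v f x y = d := by
  have h1 : HasLineDerivAt ℝ (fun x' => f x' y) d x v := hd
  rw [dX, ← (hf.differentiableAt_left hΩ h).lineDeriv_eq_fderiv, h1.lineDeriv]

lemma dY_eq_of_hasDerivAt (hΩ : IsOpen Ω) (hf : SmoothPair Ω f) (h : (x, y) ∈ Ω) {v : E} {d : V}
    (hd : HasDerivAt (fun t : ℝ => f x (y + t • v)) d 0) : dY v f x y = d := by
  have h1 : HasLineDerivAt ℝ (fun y' => f x y') d y v := hd
  rw [dY, ← (hf.differentiableAt_right hΩ h).lineDeriv_eq_fderiv, h1.lineDeriv]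

lemma SmoothPair.hasDerivAt_left (hΩ : IsOpen Ω) (hf : SmoothPair Ω f) (h : (x, y) ∈ Ω) (v : E) :
    HasDerivAt (fun t : ℝ => f (x + t • v) y) (Finsler.dX v f x y) 0 :=
  (hf.differentiableAt_left hΩ h).hasFDerivAt.hasLineDerivAt v

lemma SmoothPair.hasDerivAt_right (hΩ : IsOpen Ω) (hf : SmoothPair Ω f) (h : (x, y) ∈ Ω) (v : E) :
    HasDerivAt (fun t : ℝ => f x (y + t • v)) (Finsler.dY v f x y) 0 :=
  (hf.differentiableAt_right hΩ h).hasFDerivAt.hasLineDerivAt v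

end PartialDerivatives

/-! ### Curvature of a spray and its projective change -/

section Spray

variable {E : Type*} [NormedAddCommGroup E] [NormedSpace ℝ E]

/-- The Riemann curvature of the spray with coefficients `G`, applied to `η`. -/
def sprayCurvature (G : E → E → E) (η x y : E) : E :=
  (2 : ℝ) • dX η G x y - dX y (dY η G) x y + (2 : ℝ) • dY (G x y) (dY η G) x y
    - dY (dY η G x y) G x y

variable {Ω : Set (E × E)} {G : E → E → E} {P : E → E → ℝ} {x y : E}

lemma sprayCurvature_congr {G' : E → E → E} (hΩ : IsOpen Ω)
    (hG : ∀ x y, (x, y) ∈ Ω → G x y = G' x y) (h : (x, y) ∈ Ω) (η : E) :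
    sprayCurvature G η x y = sprayCurvature G' η x y := by
  have h1 (x y : E) (h : (x, y) ∈ Ω) : dY η G x y = dY η G' x y := dY_congr hΩ hG h η
  simp only [sprayCurvature, dX_congr hΩ hG h, dX_congr hΩ h1 h, dY_congr hΩ h1 h,
    dY_congr hΩ hG h, hG x y h]

/-- Euler's relation for the spray coefficients, which are homogeneous of degree two. -/
lemma dY_self_dY (hΩ : IsOpen Ω) (hG : SmoothPair Ω G)
    (hom : ∀ x y, (x, y) ∈ Ω → dY y G x y = (2 : ℝ) • G x y) (h : (x, y) ∈ Ω) (η : E) :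
    dY y (dY η G) x y = dY η G x y := by
  have hd : DifferentiableAt ℝ (fun y' => fderiv ℝ (fun z => G x z) y') y := by
    have : ContDiffAt ℝ ∞ (fun z => G x z) y :=
      (hG.contDiffAt hΩ h).comp y (f := fun z => (x, z)) (by fun_prop)
    exact (this.fderiv_right (m := 1) one_add_one_le_infty).differentiableAt (by simp)
  have h1 : (fun y' => fderiv ℝ (fun z => G x z) y' y') =ᶠ[nhds y] fun y' => (2 : ℝ) • G x y' :=
    (slice_right_mem hΩ h).mono fun y' hy' => hom x y' hy'
  -- Differentiating `DG(y) y = 2 G(y)` along `η` gives `D²G(η, y) + DG(η) = 2 DG(η)`.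
  have h2 := h1.fderiv_eq (𝕜 := ℝ)
  rw [fderiv_clm_apply hd (by fun_prop), 
    fderiv_fun_const_smul (hG.differentiableAt_right hΩ h) (2 : ℝ)] at h2
  have h3 := congrArg (fun A : E →L[ℝ] E => A η) h2
  simp only [add_apply, ContinuousLinearMap.comp_apply, fderiv_fun_id,
    ContinuousLinearMap.id_apply, ContinuousLinearMap.flip_apply,
    smul_apply] at h3
  have h4 : dY η (dY y G) x y = fderiv ℝ (fun y' => fderiv ℝ (fun z => G x z) y') y η y := by
    change fderiv ℝ (fun y' => fderiv ℝ (fun z => G x z) y' y) y η = _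
    rw [fderiv_clm_apply hd (by fun_prop)]; simp
  rw [dY_dY_comm hΩ hG h, h4]
  have h5 : dY η G x y = fderiv ℝ (fun z => G x z) y η := rfl
  rw [h5]
  have h6 := h3
  rw [two_smul] at h6
  exact add_left_cancel h6

/-- The effect on the Riemann curvature of a projective change `G ↦ G + P y` of the spray, up to
multiples of `y`. -/
lemma sprayCurvature_projective (hΩ : IsOpen Ω) (hG : SmoothPair Ω G) (hP : SmoothPair Ω P)
    (homG : ∀ x y, (x, y) ∈ Ω → dY y G x y = (2 : ℝ) • G x y)
    (homP : ∀ x y, (x, y) ∈ Ω → dY y P x y = P x y) (h : (x, y) ∈ Ω) (η : E) :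
    ∃ c : ℝ, sprayCurvature (fun x y => G x y + P x y • y) η x y = sprayCurvature G η x y
      + (P x y ^ 2 + 2 * dY (G x y) P x y - dX y P x y) • η + c • y := by
  have hid : SmoothPair Ω (fun _ y : E => y) := contDiff_snd.contDiffOn
  have hconst (v : E) : SmoothPair Ω (fun _ _ : E => v) := contDiffOn_const
  have hPy : SmoothPair Ω (fun x y => P x y • y) := ContDiffOn.smul hP hid
  have hXid (v x y : E) : dX v (fun _ y : E => y) x y = 0 := by simp [dX]
  have hYid (v x y : E) : dY v (fun _ y : E => y) x y = v := by simp [dY]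
  have hXc (v x y w : E) : dX v (fun _ _ : E => w) x y = 0 := by simp [dX]
  have hYc (v x y w : E) : dY v (fun _ _ : E => w) x y = 0 := by simp [dY]
  have dXG (v x y : E) (h : (x, y) ∈ Ω) :
      dX v (fun x y => G x y + P x y • y) x y = dX v G x y + dX v P x y • y := by
    rw [dX_add hΩ hG hPy h, dX_smul hΩ hP hid h, hXid]; simp
  have dYG (v x y : E) (h : (x, y) ∈ Ω) : dY v (fun x y => G x y + P x y • y) x y =
      dY v G x y + (dY v P x y • y + P x y • v) := by
    rw [dY_add hΩ hG hPy h, dY_smul hΩ hP hid h, hYid]; abel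
  have hs1 (v : E) : SmoothPair Ω (fun x y => dY v P x y • y) := ContDiffOn.smul (hP.dY hΩ v) hid
  have hs2 (v : E) : SmoothPair Ω (fun x y => P x y • v) := ContDiffOn.smul hP (hconst v)
  have hs3 (v : E) : SmoothPair Ω (fun x y => dY v P x y • y + P x y • v) :=
    ContDiffOn.add (hs1 v) (hs2 v)
  have dXdY (u v : E) : dX u (dY v (fun x y => G x y + P x y • y)) x y =
      dX u (dY v G) x y + (dX u (dY v P) x y • y + dX u P x y • v) := by
    rw [dX_congr hΩ (dYG v) h, dX_add hΩ (hG.dY hΩ v) (hs3 v) h, dX_add hΩ (hs1 v) (hs2 v) h,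
      dX_smul hΩ (hP.dY hΩ v) hid h, dX_smul hΩ hP (hconst v) h, hXid, hXc]; simp
  have dYdY (u v : E) : dY u (dY v (fun x y => G x y + P x y • y)) x y =
      dY u (dY v G) x y + (dY u (dY v P) x y • y + dY v P x y • u + dY u P x y • v) := by
    rw [dY_congr hΩ (dYG v) h, dY_add hΩ (hG.dY hΩ v) (hs3 v) h, dY_add hΩ (hs1 v) (hs2 v) h,
      dY_smul hΩ (hP.dY hΩ v) hid h, dY_smul hΩ hP (hconst v) h, hYid, hYc]
    simp; abel
  -- This collects the coefficients of `y`; the application works modulo `y`, so only its existence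
  -- matters.
  refine ⟨2 * dX η P x y - dX y (dY η P) x y + 2 * (dY (G x y + P x y • y) (dY η P) x y)
    - dY (dY η G x y) P x y - P x y * dY η P x y + 2 * (P x y * dY η P x y)
    - 2 * (P x y * dY η P x y), ?_⟩
  simp only [sprayCurvature, dXG η x y h, dXdY, dYdY, dYG η x y h, dYG _ x y h, dY_add_dir,
    dY_smul_dir, homG x y h, homP x y h, dY_self_dY hΩ hG homG h]
  simp only [smul_eq_mul]
  module

end Spray

/-! ### Riemannian metrics on open subsets of a vector space -/

section LocalGeometry

variable {E V : Type*} [NormedAddCommGroup E] [NormedSpace ℝ E]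
  [NormedAddCommGroup V] [NormedSpace ℝ V]
variable {U : Set E} {x : E}

lemma hasDerivAt_line (hU : IsOpen U) {A : E → V} (hA : ContDiffOn ℝ ∞ A U) (hx : x ∈ U) (v : E) :
    HasDerivAt (fun t : ℝ => A (x + t • v)) (fderiv ℝ A x v) 0 :=
  ((hA.contDiffAt (hU.mem_nhds hx)).differentiableAt (by simp)).hasFDerivAt.hasLineDerivAt v

lemma eq_of_hasDerivAt_line (hU : IsOpen U) {f g : E → V} (hfg : ∀ x ∈ U, f x = g x) (hx : x ∈ U)
    {v : E} {a b : V} (ha : HasDerivAt (fun t : ℝ => f (x + t • v)) a 0)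
    (hb : HasDerivAt (fun t : ℝ => g (x + t • v)) b 0) : a = b := by
  have h0 : ∀ᶠ t : ℝ in nhds 0, x + t • v ∈ U :=
    (by fun_prop : ContinuousAt (fun t : ℝ => x + t • v) 0) (hU.mem_nhds (by simpa using hx))
  have h1 : (fun t : ℝ => f (x + t • v)) =ᶠ[nhds 0] fun t : ℝ => g (x + t • v) :=
    h0.mono fun t ht => hfg _ ht
  exact ha.unique (hb.congr_of_eventuallyEq h1)

lemma contDiffOn_fderiv (hU : IsOpen U) {A : E → V} (hA : ContDiffOn ℝ ∞ A U) :
    ContDiffOn ℝ ∞ (fderiv ℝ A) U := hA.fderiv_of_isOpen hU (by simp)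

lemma fderiv_fderiv_symm (hU : IsOpen U) {A : E → V} (hA : ContDiffOn ℝ ∞ A U) (hx : x ∈ U)
    (u v : E) : fderiv ℝ (fderiv ℝ A) x u v = fderiv ℝ (fderiv ℝ A) x v u :=
  ((hA.contDiffAt (hU.mem_nhds hx)).isSymmSndFDerivAt (by simpa using two_le_infty)).eq u v

/-- A smooth Riemannian metric on an open set. -/
structure IsMetricOn (U : Set E) (H : E → E →L[ℝ] E →L[ℝ] ℝ) : Prop where
  isOpen : IsOpen U
  smooth : ContDiffOn ℝ ∞ H U
  symm : ∀ x ∈ U, ∀ u v, H x u v = H x v u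
  pos : ∀ x ∈ U, ∀ v, v ≠ 0 → 0 < H x v v

variable {H : E → E →L[ℝ] E →L[ℝ] ℝ}

/-- The vector dual to a covector. -/
def sharp (H : E → E →L[ℝ] E →L[ℝ] ℝ) (x : E) : (E →L[ℝ] ℝ) →L[ℝ] E := (H x).inverse

/-- The covector valued bilinear map `2 ⟨Γ(u, v), ·⟩`. -/
def koszulForm (H : E → E →L[ℝ] E →L[ℝ] ℝ) (x : E) : E →L[ℝ] E →L[ℝ] E →L[ℝ] ℝ :=
  fderiv ℝ H x + (fderiv ℝ H x).flip -
    (ContinuousLinearMap.flipₗᵢ ℝ E E ℝ).toContinuousLinearEquiv.toContinuousLinearMap.comp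
      (fderiv ℝ H x).flip

lemma koszulForm_apply (u v z : E) : koszulForm H x u v z =
    fderiv ℝ H x u v z + fderiv ℝ H x v u z - fderiv ℝ H x z u v := by
  simp [koszulForm]

/-- The Christoffel symbols of a metric, as a bilinear map. -/
def gam (H : E → E →L[ℝ] E →L[ℝ] ℝ) (x : E) : E →L[ℝ] E →L[ℝ] E :=
  (ContinuousLinearMap.compL ℝ E (E →L[ℝ] ℝ) E (sharp H x)).comp ((1 / 2 : ℝ) • koszulForm H x)

/-- The curvature `R(u, v) z` of a metric. -/
def riem (H : E → E →L[ℝ] E →L[ℝ] ℝ) (x u v z : E) : E :=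
  fderiv ℝ (gam H) x u v z - fderiv ℝ (gam H) x v u z
    + gam H x u (gam H x v z) - gam H x v (gam H x u z)

/-- The covariant derivative `v ↦ ∇_v W` of a vector field. -/
def cov (H : E → E →L[ℝ] E →L[ℝ] ℝ) (W : E → E) (x : E) : E →L[ℝ] E :=
  fderiv ℝ W x + (gam H x).flip (W x)

lemma cov_apply {W : E → E} (v : E) : cov H W x v = fderiv ℝ W x v + gam H x v (W x) := by
  simp [cov]

/-- The second covariant derivative `(∇_u ∇W) v` of a vector field. -/
def cov2 (H : E → E →L[ℝ] E →L[ℝ] ℝ) (W : E → E) (x u v : E) : E :=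
  fderiv ℝ (cov H W) x u v + gam H x u (cov H W x v) - cov H W x (gam H x u v)

lemma riem_antisymm (H : E → E →L[ℝ] E →L[ℝ] ℝ) (x u v z : E) : riem H x u v z = - riem H x v u z := by
  simp only [riem]; abel

namespace IsMetricOn

lemma fderiv_symm (hH : IsMetricOn U H) (hx : x ∈ U) (v a b : E) : fderiv ℝ H x v a b = fderiv ℝ H x v b a := by
  have h1 := hasDerivAt_line hH.isOpen hH.smooth hx v
  have h2 (a b : E) := (h1.clm_apply (hasDerivAt_const (0 : ℝ) a)).clm_apply
    (hasDerivAt_const (0 : ℝ) b)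
  have := eq_of_hasDerivAt_line hH.isOpen (f := fun x => H x a b) (g := fun x => H x b a)
    (fun x hx => hH.symm x hx a b) hx (h2 a b) (h2 b a)
  simpa using this


section

variable [FiniteDimensional ℝ E] (hH : IsMetricOn U H)
include hH

lemma isInvertible (hx : x ∈ U) : (H x).IsInvertible := by
  have hinj : Function.Injective (H x : E →ₗ[ℝ] E →L[ℝ] ℝ) := by
    rw [← LinearMap.ker_eq_bot, LinearMap.ker_eq_bot']
    intro v hv
    by_contra h0
    have := hH.pos x hx v h0
    have h1 : H x v = 0 := hv
    rw [h1] at this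
    simp at this
  have hdim : Module.finrank ℝ E = Module.finrank ℝ (E →L[ℝ] ℝ) := by
    rw [← (LinearMap.toContinuousLinearMap : (E →ₗ[ℝ] ℝ) ≃ₗ[ℝ] _).finrank_eq]
    exact (Subspace.dual_finrank_eq (K := ℝ) (V := E)).symm
  refine ⟨(LinearEquiv.ofInjectiveOfFinrankEq (H x : E →ₗ[ℝ] E →L[ℝ] ℝ) hinj
    hdim).toContinuousLinearEquiv, ?_⟩
  ext v w
  rfl

lemma apply_sharp (hx : x ∈ U) (φ : E →L[ℝ] ℝ) (v : E) : H x (sharp H x φ) v = φ v := by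
  rw [sharp, (hH.isInvertible hx).self_apply_inverse]

lemma ext (hx : x ∈ U) {u v : E} (h : ∀ z, H x u z = H x v z) : u = v := by
  by_contra h0
  have := hH.pos x hx (u - v) (sub_ne_zero.2 h0)
  rw [map_sub (H x), sub_apply, h, sub_self] at this
  exact lt_irrefl _ this

lemma smooth_sharp : ContDiffOn ℝ ∞ (sharp H) U := by
  intro x hx
  have : FiniteDimensional ℝ (E →L[ℝ] ℝ) := inferInstance
  have : CompleteSpace E := FiniteDimensional.complete ℝ E
  exact ((hH.isInvertible hx).contDiffAt_map_inverse).comp_contDiffWithinAt x (hH.smooth x hx)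

lemma smooth_gam : ContDiffOn ℝ ∞ (gam H) U := by
  have h1 : ContDiffOn ℝ ∞ (fderiv ℝ H) U := contDiffOn_fderiv hH.isOpen hH.smooth
  have h2 : ContDiffOn ℝ ∞ (fun x => (fderiv ℝ H x).flip) U :=
    (ContinuousLinearMap.flipₗᵢ ℝ E E (E →L[ℝ] ℝ)).contDiff.comp_contDiffOn h1
  have h3 : ContDiffOn ℝ ∞ (koszulForm H) U :=
    (h1.add h2).sub (contDiffOn_const.clm_comp h2)
  exact ((ContinuousLinearMap.contDiff _).comp_contDiffOn hH.smooth_sharp).clm_comp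
    (h3.const_smul (1 / 2 : ℝ))

lemma apply_gam (hx : x ∈ U) (u v z : E) : H x (gam H x u v) z =
    (1 / 2) * (fderiv ℝ H x u v z + fderiv ℝ H x v u z - fderiv ℝ H x z u v) := by
  have : gam H x u v = sharp H x ((1 / 2 : ℝ) • koszulForm H x u v) := rfl
  rw [this, hH.apply_sharp hx]
  simp [koszulForm_apply]

lemma gam_symm (hx : x ∈ U) (u v : E) : gam H x u v = gam H x v u := by
  refine hH.ext hx fun z => ?_
  rw [hH.apply_gam hx, hH.apply_gam hx, hH.fderiv_symm hx z u v]
  ring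

/-- Metric compatibility of the Levi-Civita connection; it is the rule by which every later
derivative of an inner product is made covariant. -/
lemma compat (hx : x ∈ U) (v a b : E) :
    fderiv ℝ H x v a b = H x (gam H x v a) b + H x a (gam H x v b) := by
  rw [hH.symm x hx a, hH.apply_gam hx, hH.apply_gam hx, hH.fderiv_symm hx a v b,
    hH.fderiv_symm hx b v a, hH.fderiv_symm hx v b a]
  ring

lemma fderiv_gam_symm (hx : x ∈ U) (w u v : E) :
    fderiv ℝ (gam H) x w u v = fderiv ℝ (gam H) x w v u := by
  have h1 := hasDerivAt_line hH.isOpen hH.smooth_gam hx w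
  have h2 (a b : E) := (h1.clm_apply (hasDerivAt_const (0 : ℝ) a)).clm_apply
    (hasDerivAt_const (0 : ℝ) b)
  have := eq_of_hasDerivAt_line hH.isOpen (f := fun x => gam H x u v) (g := fun x => gam H x v u)
    (fun x hx => hH.gam_symm hx u v) hx (h2 u v) (h2 v u)
  simpa using this

lemma bianchi (hx : x ∈ U) (u v z : E) :
    riem H x u v z + riem H x v z u + riem H x z u v = 0 := by
  simp only [riem]
  rw [hH.gam_symm hx v z, hH.gam_symm hx u z, hH.gam_symm hx v u, hH.fderiv_gam_symm hx u v z,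
    hH.fderiv_gam_symm hx v u z, hH.fderiv_gam_symm hx z u v]
  abel

lemma riem_skew_adjoint (hx : x ∈ U) (u v a b : E) :
    H x (riem H x u v a) b = - H x a (riem H x u v b) := by
  -- The second derivative of the metric, computed from compatibility. It is symmetric in `u` and
  -- `v`, and its antisymmetric part is the claim.
  have key (u v : E) : fderiv ℝ (fderiv ℝ H) x u v a b =
      H x (gam H x u (gam H x v a)) b + H x (gam H x v a) (gam H x u b)
      + H x (fderiv ℝ (gam H) x u v a) b + H x (gam H x u a) (gam H x v b)
      + H x a (gam H x u (gam H x v b)) + H x a (fderiv ℝ (gam H) x u v b) := by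
    have hc (a : E) := hasDerivAt_const (0 : ℝ) a
    have h1 := ((hasDerivAt_line hH.isOpen (contDiffOn_fderiv hH.isOpen hH.smooth) hx u).clm_apply
      (hc v)).clm_apply (hc a) |>.clm_apply (hc b)
    have hG := hasDerivAt_line hH.isOpen hH.smooth_gam hx u
    have hh := hasDerivAt_line hH.isOpen hH.smooth hx u
    have h2 := ((hh.clm_apply ((hG.clm_apply (hc v)).clm_apply (hc a))).clm_apply (hc b)).add
      ((hh.clm_apply (hc a)).clm_apply ((hG.clm_apply (hc v)).clm_apply (hc b)))
    have := eq_of_hasDerivAt_line hH.isOpen (f := fun x => fderiv ℝ H x v a b)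
      (g := fun x => H x (gam H x v a) b + H x a (gam H x v b))
      (fun x hx => hH.compat hx v a b) hx h1 h2
    simp only [map_zero, add_zero, zero_smul, add_apply] at this
    rw [this, hH.compat hx, hH.compat hx]
    ring
  have h3 := key u v
  rw [fderiv_fderiv_symm hH.isOpen hH.smooth hx, key v u] at h3
  simp only [riem, map_add, map_sub, add_apply, sub_apply]
  linarith

/-- The classical octahedron argument: four instances of the Bianchi identity, combined by the skew
symmetry in each of the two pairs of arguments. -/
lemma riem_pair_symm (hx : x ∈ U) (a b c d : E) :
    H x (riem H x a b c) d = H x (riem H x c d a) b := by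
  have hb (a b c d : E) : H x (riem H x a b c) d + H x (riem H x b c a) d
      + H x (riem H x c a b) d = 0 := by
    rw [← add_apply, ← map_add, ← add_apply, ← map_add, hH.bianchi hx]; simp
  have hs (a b c d : E) : H x (riem H x a b c) d = - H x (riem H x a b d) c := by
    rw [hH.riem_skew_adjoint hx, hH.symm x hx]
  have ha (a b c d : E) : H x (riem H x a b c) d = - H x (riem H x b a c) d := by
    rw [riem_antisymm]; simp
  linarith [hb a b c d, hb b c d a, hb c d a b, hb d a b c, hs a b c d, hs b c a d, hs c a b d,
    hs b c d a, hs c d b a, hs d b c a, hs c d a b, hs d a c b, hs a c d b, hs d a b c,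
    hs a b d c, hs b d a c, ha a b c d, ha b c a d, ha c a b d, ha c d a b, ha d a b c, ha b d a c,
    ha b d c a, ha a c d b, ha a c b d, ha d b a c, ha c a d b, ha d b c a]

end

end IsMetricOn

/-! ### Unit vector fields -/

/-- A smooth vector field of length one. -/
structure IsUnitFieldOn (U : Set E) (H : E → E →L[ℝ] E →L[ℝ] ℝ) (W : E → E) : Prop where
  smooth : ContDiffOn ℝ ∞ W U
  unit : ∀ x ∈ U, H x (W x) (W x) = 1

namespace IsUnitFieldOn

section

variable [FiniteDimensional ℝ E] {W : E → E} (hH : IsMetricOn U H) (hW : IsUnitFieldOn U H W)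
include hH hW

lemma smooth_cov : ContDiffOn ℝ ∞ (cov H W) U :=
  (contDiffOn_fderiv hH.isOpen hW.smooth).add
    (((ContinuousLinearMap.flipₗᵢ ℝ E E E).contDiff.comp_contDiffOn hH.smooth_gam).clm_apply
      hW.smooth)

/-- Derivative of `⟨W,W⟩ = 1`; no Killing condition enters. -/
lemma apply_cov_self (hx : x ∈ U) (v : E) : H x (cov H W x v) (W x) = 0 := by
  have h1 := hasDerivAt_line hH.isOpen hH.smooth hx v
  have h2 := hasDerivAt_line hH.isOpen hW.smooth hx v
  have := eq_of_hasDerivAt_line hH.isOpen (g := fun _ => (1 : ℝ)) hW.unit hx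
    ((h1.clm_apply h2).clm_apply h2) (hasDerivAt_const (0 : ℝ) (1 : ℝ))
  simp only [zero_smul, add_zero, add_apply, hH.compat hx, hH.symm x hx (W x)] at this
  rw [cov_apply, map_add, add_apply]
  linarith

/-- The Ricci identity: the second derivatives of `W` cancel by symmetry, leaving curvature. -/
lemma cov2_sub (hx : x ∈ U) (u v : E) :
    cov2 H W x u v - cov2 H W x v u = riem H x u v (W x) := by
  have key (u v : E) : fderiv ℝ (cov H W) x u v = fderiv ℝ (fderiv ℝ W) x u v
      + (fderiv ℝ (gam H) x u v (W x) + gam H x v (fderiv ℝ W x u)) := by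
    have hc := hasDerivAt_const (0 : ℝ) v
    have h1 := (hasDerivAt_line hH.isOpen (hW.smooth_cov hH) hx u).clm_apply hc
    have h2 := ((hasDerivAt_line hH.isOpen (contDiffOn_fderiv hH.isOpen hW.smooth) hx u).clm_apply
      hc).add (((hasDerivAt_line hH.isOpen hH.smooth_gam hx u).clm_apply hc).clm_apply
      (hasDerivAt_line hH.isOpen hW.smooth hx u))
    have := eq_of_hasDerivAt_line hH.isOpen (f := fun x => cov H W x v)
      (fun x _ => cov_apply v) hx h1 h2
    simpa using this
  simp only [cov2, riem, key, cov_apply, map_add]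
  rw [fderiv_fderiv_symm hH.isOpen hW.smooth hx u v, hH.gam_symm hx u v]
  abel

/-! ### Unit Killing fields -/

section Killing

variable (hK : ∀ x ∈ U, ∀ u v, H x (cov H W x u) v = - H x u (cov H W x v))
include hK

/-- The covariant derivative of the Killing equation: along with `∇W`, each `∇_u(∇W)` is skew. -/
lemma cov2_skew (hx : x ∈ U) (u v z : E) :
    H x (cov2 H W x u v) z = - H x (cov2 H W x u z) v := by
  have hB := hasDerivAt_line hH.isOpen (hW.smooth_cov hH) hx u
  have hh := hasDerivAt_line hH.isOpen hH.smooth hx u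
  have hc (a : E) := hasDerivAt_const (0 : ℝ) a
  have h1 := (hh.clm_apply (hB.clm_apply (hc v))).clm_apply (hc z)
  have h2 := ((hh.clm_apply (hc v)).clm_apply (hB.clm_apply (hc z))).neg
  have h3 := eq_of_hasDerivAt_line hH.isOpen (f := fun x => H x (cov H W x v) z)
    (fun x hx => hK x hx v z) hx h1 h2
  simp only [map_zero, add_zero, zero_smul, add_apply] at h3
  simp only [hH.compat hx] at h3
  have e1 := hK x hx (gam H x u v) z
  have e2 := hK x hx (gam H x u z) v
  have e3 := hH.symm x hx (gam H x u v) (cov H W x z)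
  have e4 := hH.symm x hx (cov H W x v) (gam H x u z)
  have e5 := hH.symm x hx (gam H x u (cov H W x z)) v
  have e6 := hH.symm x hx (fderiv ℝ (cov H W) x u z) v
  simp only [cov2, map_add, map_sub, add_apply, sub_apply]
  linarith

/-- Kostant's formula for the second covariant derivative of a Killing field. -/
lemma cov2_eq (hx : x ∈ U) (u v : E) : cov2 H W x u v = - riem H x (W x) u v := by
  refine hH.ext hx fun z => ?_
  have hr (u v z : E) : H x (cov2 H W x u v) z - H x (cov2 H W x v u) z =
      H x (riem H x u v (W x)) z := by
    rw [← hW.cov2_sub hH hx, map_sub, sub_apply]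
  have hp (u v z : E) : H x (riem H x u v (W x)) z = H x (riem H x (W x) z u) v :=
    hH.riem_pair_symm hx _ _ _ _
  have ha (u v z : E) : H x (riem H x u v (W x)) z = - H x (riem H x u v z) (W x) := by
    rw [hH.riem_skew_adjoint hx, hH.symm x hx]
  have hb : H x (riem H x u v z) (W x) + H x (riem H x v z u) (W x)
      + H x (riem H x z u v) (W x) = 0 := by
    rw [← add_apply, ← map_add, ← add_apply, ← map_add, hH.bianchi hx]; simp
  have hq : H x (riem H x v z (W x)) u = H x (riem H x (W x) u v) z := hp v z u
  simp only [map_neg, neg_apply]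
  -- As in Koszul's formula: the Ricci identity at the three cyclic permutations, with skewness in
  -- the last two arguments, isolates `∇²W`, and the Bianchi identity leaves one curvature term.
  linarith [hr u v z, hr v z u, hr z u v, hW.cov2_skew hH hK hx u v z, hW.cov2_skew hH hK hx v z u,
    hW.cov2_skew hH hK hx z u v, ha u v z, ha v z u, ha z u v]

/-- `⟨∇_W W,z⟩ = -⟨W,∇_z W⟩ = 0` as `W` has constant length: its integral curves are geodesics. -/
lemma cov_field (hx : x ∈ U) : cov H W x (W x) = 0 := by
  refine hH.ext hx fun z => ?_
  rw [hK x hx, hH.symm x hx, hW.apply_cov_self hH hx]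
  simp

/-- Differentiating `∇_W W = 0` along `u` gives `(∇_u ∇W) W + ∇W(∇_u W) = 0`, and Kostant's formula
evaluates the first term. -/
lemma cov_cov (hx : x ∈ U) (u : E) :
    cov H W x (cov H W x u) = riem H x (W x) u (W x) := by
  have hB := hasDerivAt_line hH.isOpen (hW.smooth_cov hH) hx u
  have h1 := eq_of_hasDerivAt_line hH.isOpen (f := fun x => cov H W x (W x))
    (fun x hx => hW.cov_field hH hK hx) hx
    (hB.clm_apply (hasDerivAt_line hH.isOpen hW.smooth hx u)) (hasDerivAt_const (0 : ℝ) (0 : E))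
  simp only [zero_smul, add_zero] at h1
  have h2 := hW.cov2_eq hH hK hx u (W x)
  simp only [cov2, hW.cov_field hH hK hx, map_zero, add_zero] at h2
  rw [cov_apply u, map_add, ← neg_eq_iff_eq_neg.2 h2, eq_neg_of_add_eq_zero_right h1]
  abel

end Killing

end

end IsUnitFieldOn

end LocalGeometry

/-! ### The Kropina function of a metric and a unit vector field -/

section Kropina

variable {E : Type*} [NormedAddCommGroup E] [NormedSpace ℝ E]
variable {U : Set E} {H : E → E →L[ℝ] E →L[ℝ] ℝ} {W : E → E} {x y : E}

/-- The domain `⟨W, y⟩ > 0` of the Kropina function. -/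
def cone (U : Set E) (H : E → E →L[ℝ] E →L[ℝ] ℝ) (W : E → E) : Set (E × E) :=
  {p | p.1 ∈ U ∧ 0 < H p.1 (W p.1) p.2}

/-- The function `F = ⟨y, y⟩ / (2 ⟨W, y⟩)`. -/
def kro (H : E → E →L[ℝ] E →L[ℝ] ℝ) (W : E → E) (x y : E) : ℝ := H x y y / (2 * H x (W x) y)

/-- The derivative of `kro` in `y`. -/
def kro1 (H : E → E →L[ℝ] E →L[ℝ] ℝ) (W : E → E) (x y ξ : E) : ℝ :=
  (H x y ξ - kro H W x y * H x (W x) ξ) / H x (W x) y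

/-- The second derivative of `kro` in `y`. -/
def kro2 (H : E → E →L[ℝ] E →L[ℝ] ℝ) (W : E → E) (x y η ξ : E) : ℝ :=
  (H x η ξ - kro1 H W x y η * H x (W x) ξ - kro1 H W x y ξ * H x (W x) η) / H x (W x) y

/-- The adjoint of the covariant derivative of a vector field. -/
def covAdj (H : E → E →L[ℝ] E →L[ℝ] ℝ) (W : E → E) (x : E) : E →L[ℝ] E :=
  (sharp H x).comp (((ContinuousLinearMap.compL ℝ E E ℝ).flip (cov H W x)).comp (H x))

/-- The part of the spray of the Kropina function without denominators `⟨y, y⟩`. -/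
def kroSprayReg (H : E → E →L[ℝ] E →L[ℝ] ℝ) (W : E → E) (x y : E) : E :=
  (1 / 2 : ℝ) • gam H x y y - (kro H W x y / 2) • (cov H W x y - covAdj H W x y)
    + (H x (cov H W x y) y / 2 - kro H W x y * H x (cov H W x (W x)) y / 2) • W x
    + (H x (cov H W x (W x)) y / 2) • y

/-- The projective part of the spray of the Kropina function. -/
def kroSprayProj (H : E → E →L[ℝ] E →L[ℝ] ℝ) (W : E → E) (x y : E) : ℝ :=
  - (H x (cov H W x y) y * H x (W x) y) / H x y y

lemma kro_smul_pos {t : ℝ} (ht : 0 < t) : kro H W x (t • y) = t * kro H W x y := by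
  simp only [kro, map_smul, smul_apply, smul_eq_mul]
  by_cases h : H x (W x) y = 0
  · simp [h]
  · field_simp

lemma kroSprayReg_smul {t : ℝ} (ht : 0 < t) :
    kroSprayReg H W x (t • y) = t ^ 2 • kroSprayReg H W x y := by
  simp only [kroSprayReg, kro_smul_pos ht, map_smul, smul_apply, smul_eq_mul]
  module

lemma kroSprayProj_smul {t : ℝ} (ht : 0 < t) :
    kroSprayProj H W x (t • y) = t * kroSprayProj H W x y := by
  simp only [kroSprayProj, map_smul, smul_apply, smul_eq_mul]
  by_cases h : H x y y = 0
  · simp [h]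
  · field_simp

section

variable [FiniteDimensional ℝ E] (hH : IsMetricOn U H) (hW : IsUnitFieldOn U H W)
include hH

lemma apply_covAdj (hx : x ∈ U) (u v : E) : H x (covAdj H W x u) v = H x u (cov H W x v) := by
  simp only [covAdj, ContinuousLinearMap.comp_apply, hH.apply_sharp hx]
  rfl

include hW

/-! ### Smoothness and derivatives of the Kropina function -/

lemma smooth_fst_cone {V : Type*} [NormedAddCommGroup V] [NormedSpace ℝ V] {A : E → V}
    (hA : ContDiffOn ℝ ∞ A U) : SmoothPair (cone U H W) (fun x _ => A x) :=
  hA.comp contDiffOn_fst fun _ hp => hp.1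

lemma isOpen_cone : IsOpen (cone U H W) := by
  have hc : ContinuousOn (fun p : E × E => H p.1 (W p.1) p.2) (U ×ˢ Set.univ) := by
    have h1 : ContinuousOn (fun p : E × E => H p.1) (U ×ˢ Set.univ) :=
      hH.smooth.continuousOn.comp continuousOn_fst fun _ hp => hp.1
    have h2 : ContinuousOn (fun p : E × E => W p.1) (U ×ˢ Set.univ) :=
      hW.smooth.continuousOn.comp continuousOn_fst fun _ hp => hp.1
    exact (h1.clm_apply h2).clm_apply continuousOn_snd
  have := hc.isOpen_inter_preimage (hH.isOpen.prod isOpen_univ) (isOpen_Ioi (a := (0 : ℝ)))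
  convert this using 1
  ext p
  simp [cone]

lemma sq_pos_of_mem_cone (h : (x, y) ∈ cone U H W) : 0 < H x y y := by
  refine hH.pos x h.1 y fun h0 => ?_
  have := h.2
  simp [h0] at this

lemma kro_pos (h : (x, y) ∈ cone U H W) : 0 < kro H W x y :=
  div_pos (sq_pos_of_mem_cone hH hW h) (mul_pos two_pos h.2)

lemma sq_eq_kro (h : (x, y) ∈ cone U H W) : H x y y = 2 * H x (W x) y * kro H W x y := by
  have := h.2.ne'
  simp only at this
  rw [kro]; field_simp

lemma smooth_wind : SmoothPair (cone U H W) (fun x y => H x (W x) y) :=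
  ContDiffOn.clm_apply (smooth_fst_cone hH hW (hH.smooth.clm_apply hW.smooth)) contDiffOn_snd

lemma smooth_sq : SmoothPair (cone U H W) (fun x y => H x y y) :=
  ((smooth_fst_cone hH hW hH.smooth).clm_apply contDiffOn_snd).clm_apply contDiffOn_snd

lemma smooth_kro : SmoothPair (cone U H W) (kro H W) :=
  ContDiffOn.div (smooth_sq hH hW) (contDiffOn_const.mul (smooth_wind hH hW))
    fun _ hp => mul_ne_zero two_ne_zero hp.2.ne'

lemma smooth_kro1 (ξ : E) : SmoothPair (cone U H W) (fun x y => kro1 H W x y ξ) :=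
  ContDiffOn.div ((((smooth_fst_cone hH hW hH.smooth).clm_apply contDiffOn_snd).clm_apply
    contDiffOn_const).sub ((smooth_kro hH hW).mul
      ((smooth_fst_cone hH hW (hH.smooth.clm_apply hW.smooth)).clm_apply contDiffOn_const)))
    (smooth_wind hH hW) fun _ hp => hp.2.ne'

lemma dY_kro (h : (x, y) ∈ cone U H W) (ξ : E) : dY ξ (kro H W) x y = kro1 H W x y ξ := by
  have hw : H x (W x) y ≠ 0 := h.2.ne'
  have hy : HasDerivAt (fun t : ℝ => y + t • ξ) ξ 0 := by
    simpa using ((hasDerivAt_id (0 : ℝ)).smul_const ξ).const_add y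
  have hq := ((hasDerivAt_const (0 : ℝ) (H x)).clm_apply hy).clm_apply hy
  have hl := (hasDerivAt_const (0 : ℝ) (H x (W x))).clm_apply hy
  refine dY_eq_of_hasDerivAt (isOpen_cone hH hW) (smooth_kro hH hW) h
    ((hq.div (hl.const_mul 2) (by simpa using hw)).congr_deriv ?_)
  simp only [zero_smul, add_zero, zero_add, zero_apply, kro1, kro,
    hH.symm x h.1 ξ y]
  field_simp
  ring

lemma dY_kro1 (h : (x, y) ∈ cone U H W) (η ξ : E) :
    dY η (fun x y => kro1 H W x y ξ) x y = kro2 H W x y η ξ := by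
  have hw : H x (W x) y ≠ 0 := h.2.ne'
  have hy : HasDerivAt (fun t : ℝ => y + t • η) η 0 := by
    simpa using ((hasDerivAt_id (0 : ℝ)).smul_const η).const_add y
  have hF := (smooth_kro hH hW).hasDerivAt_right (isOpen_cone hH hW) h η
  rw [dY_kro hH hW h] at hF
  have hq := ((hasDerivAt_const (0 : ℝ) (H x)).clm_apply hy).clm_apply (hasDerivAt_const (0 : ℝ) ξ)
  have hl := (hasDerivAt_const (0 : ℝ) (H x (W x))).clm_apply hy
  refine dY_eq_of_hasDerivAt (isOpen_cone hH hW) (smooth_kro1 hH hW ξ) h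
    (((hq.sub (hF.mul_const (H x (W x) ξ))).div hl (by simpa using hw)).congr_deriv ?_)
  simp only [zero_smul, add_zero, zero_add, zero_apply, map_zero, kro2]
  -- The definition of `dF` solved for `⟨y,ξ⟩`, so that `dF(ξ)` can stay an independent unknown in
  -- the rational identity.
  have e : H x y ξ = kro1 H W x y ξ * H x (W x) y + kro H W x y * H x (W x) ξ := by
    rw [kro1]; field_simp; ring
  rw [Pi.sub_apply, zero_smul, add_zero, e]
  field_simp
  ring

/-- The derivative of the covector `⟨W,·⟩`, split into its covariant part and a Christoffel
correction. -/
lemma fderiv_wind (hx : x ∈ U) (v z : E) : fderiv ℝ H x v (W x) z + H x (fderiv ℝ W x v) z =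
    H x (cov H W x v) z + H x (W x) (gam H x v z) := by
  rw [hH.compat hx, cov_apply, map_add, add_apply]; ring

/-- The metric is parallel, so apart from the Christoffel term `dF(Γ(v,y))` the function `F` varies
with `x` only through `∇W`. -/
lemma dX_kro (h : (x, y) ∈ cone U H W) (v : E) : dX v (kro H W) x y =
    kro1 H W x y (gam H x v y) - kro H W x y * H x (cov H W x v) y / H x (W x) y := by
  have hw : H x (W x) y ≠ 0 := h.2.ne'
  have hc (a : E) := hasDerivAt_const (0 : ℝ) a
  have hh := hasDerivAt_line hH.isOpen hH.smooth h.1 v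
  have hq := (hh.clm_apply (hc y)).clm_apply (hc y)
  have hl := (hh.clm_apply (hasDerivAt_line hH.isOpen hW.smooth h.1 v)).clm_apply (hc y)
  refine dX_eq_of_hasDerivAt (isOpen_cone hH hW) (smooth_kro hH hW) h
    ((hq.div (hl.const_mul 2) (by simpa using hw)).congr_deriv ?_)
  simp only [zero_smul, add_zero, add_apply, map_zero]
  rw [fderiv_wind hH hW h.1, hH.compat h.1, kro1, kro, hH.symm x h.1 _ y]
  field_simp
  ring

lemma dX_kro1 (h : (x, y) ∈ cone U H W) (v ξ : E) : dX v (fun x y => kro1 H W x y ξ) x y =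
    (H x (gam H x v y) ξ + H x y (gam H x v ξ) - dX v (kro H W) x y * H x (W x) ξ
      - kro H W x y * (H x (cov H W x v) ξ + H x (W x) (gam H x v ξ))
      - kro1 H W x y ξ * (H x (cov H W x v) y + H x (W x) (gam H x v y))) / H x (W x) y := by
  have hw : H x (W x) y ≠ 0 := h.2.ne'
  have hc (a : E) := hasDerivAt_const (0 : ℝ) a
  have hF := (smooth_kro hH hW).hasDerivAt_left (isOpen_cone hH hW) h v
  have hh := hasDerivAt_line hH.isOpen hH.smooth h.1 v
  have hq := (hh.clm_apply (hc y)).clm_apply (hc ξ)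
  have hl (a : E) := (hh.clm_apply (hasDerivAt_line hH.isOpen hW.smooth h.1 v)).clm_apply (hc a)
  refine dX_eq_of_hasDerivAt (isOpen_cone hH hW) (smooth_kro1 hH hW ξ) h
    (((hq.sub (hF.mul (hl ξ))).div (hl y) (by simpa using hw)).congr_deriv ?_)
  simp only [zero_smul, add_zero, add_apply, map_zero, Pi.sub_apply, Pi.mul_apply]
  rw [fderiv_wind hH hW h.1, fderiv_wind hH hW h.1, hH.compat h.1]
  have e : H x y ξ = kro1 H W x y ξ * H x (W x) y + kro H W x y * H x (W x) ξ := by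
    rw [kro1]; field_simp; ring
  rw [e]
  field_simp
  ring

lemma smooth_kro_sq : SmoothPair (cone U H W) (fun x y => kro H W x y ^ 2) :=
  ContDiffOn.pow (smooth_kro hH hW) 2

lemma dX_kro_sq (h : (x, y) ∈ cone U H W) (v : E) :
    dX v (fun x y => kro H W x y ^ 2) x y = 2 * kro H W x y * dX v (kro H W) x y := by
  have hF := (smooth_kro hH hW).hasDerivAt_left (isOpen_cone hH hW) h v
  refine dX_eq_of_hasDerivAt (isOpen_cone hH hW) (smooth_kro_sq hH hW) h
    ((hF.pow 2).congr_deriv (by simp))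

lemma dY_kro_sq (h : (x, y) ∈ cone U H W) (ξ : E) :
    dY ξ (fun x y => kro H W x y ^ 2) x y = 2 * kro H W x y * kro1 H W x y ξ := by
  have hF := (smooth_kro hH hW).hasDerivAt_right (isOpen_cone hH hW) h ξ
  rw [dY_kro hH hW h] at hF
  refine dY_eq_of_hasDerivAt (isOpen_cone hH hW) (smooth_kro_sq hH hW) h
    ((hF.pow 2).congr_deriv (by simp))

lemma dY_dY_kro_sq (h : (x, y) ∈ cone U H W) (η ξ : E) :
    dY η (dY ξ (fun x y => kro H W x y ^ 2)) x y =
      2 * (kro1 H W x y η * kro1 H W x y ξ + kro H W x y * kro2 H W x y η ξ) := by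
  rw [dY_congr (isOpen_cone hH hW) (fun x y h => dY_kro_sq hH hW h ξ) h]
  have hF := (smooth_kro hH hW).hasDerivAt_right (isOpen_cone hH hW) h η
  have hF1 := (smooth_kro1 hH hW ξ).hasDerivAt_right (isOpen_cone hH hW) h η
  rw [dY_kro hH hW h] at hF
  rw [dY_kro1 hH hW h] at hF1
  refine dY_eq_of_hasDerivAt (isOpen_cone hH hW)
    (((smooth_kro_sq hH hW).dY (isOpen_cone hH hW) ξ).congr
      fun x y h => (dY_kro_sq hH hW h ξ).symm) h
    (((hF.const_mul 2).mul hF1).congr_deriv ?_)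
  simp only [zero_smul, add_zero]
  ring

lemma dX_dY_kro_sq (h : (x, y) ∈ cone U H W) (v ξ : E) :
    dX v (dY ξ (fun x y => kro H W x y ^ 2)) x y =
      2 * (dX v (kro H W) x y * kro1 H W x y ξ +
        kro H W x y * dX v (fun x y => kro1 H W x y ξ) x y) := by
  rw [dX_congr (isOpen_cone hH hW) (fun x y h => dY_kro_sq hH hW h ξ) h]
  have hF := (smooth_kro hH hW).hasDerivAt_left (isOpen_cone hH hW) h v
  have hF1 := (smooth_kro1 hH hW ξ).hasDerivAt_left (isOpen_cone hH hW) h v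
  refine dX_eq_of_hasDerivAt (isOpen_cone hH hW)
    (((smooth_kro_sq hH hW).dY (isOpen_cone hH hW) ξ).congr
      fun x y h => (dY_kro_sq hH hW h ξ).symm) h
    (((hF.const_mul 2).mul hF1).congr_deriv ?_)
  simp only [zero_smul, add_zero]
  ring

/-- The fundamental tensor of the Kropina function is definite. -/
lemma eq_zero_of_kro_form (h : (x, y) ∈ cone U H W) {η : E}
    (h0 : kro1 H W x y η * kro1 H W x y η + kro H W x y * kro2 H W x y η η = 0) : η = 0 := by
  have hw : 0 < H x (W x) y := h.2
  have hF := kro_pos hH hW h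
  -- Subtracting this multiple of `y` moves `η` into the kernel of `⟨W,·⟩`. Then `d²F(η,η) = |η - c
  -- y|² / ⟨W,y⟩`, so `d²F` degenerates only along `y`, where `dF(y) = F ≠ 0`.
  set c := H x (W x) η / H x (W x) y with hc
  have hcw : H x (W x) η = c * H x (W x) y := by rw [hc]; field_simp
  have e : H x y η = kro1 H W x y η * H x (W x) y + kro H W x y * H x (W x) η := by
    rw [kro1]; field_simp; ring
  have h2 : kro2 H W x y η η = H x (η - c • y) (η - c • y) / H x (W x) y := by
    simp only [kro2, map_sub, sub_apply, map_smul, smul_apply, smul_eq_mul]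
    rw [hH.symm x h.1 η y, e, sq_eq_kro hH hW h, hcw]
    field_simp
    ring
  have h3 : η - c • y = 0 := by
    by_contra hne
    have : 0 < kro2 H W x y η η := by
      rw [h2]; exact div_pos (hH.pos x h.1 _ hne) hw
    nlinarith [mul_self_nonneg (kro1 H W x y η), mul_pos hF this]
  rw [h2, h3] at h0
  have h4 : kro1 H W x y η = 0 := by simpa using h0
  have h5 : η = c • y := sub_eq_zero.1 h3
  have h6 : kro1 H W x y η = c * kro H W x y := by
    rw [kro1, h5]
    simp only [map_smul, smul_eq_mul]
    rw [sq_eq_kro hH hW h]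
    field_simp
    ring
  rw [h4] at h6
  have : c = 0 := (mul_eq_zero.1 h6.symm).resolve_right hF.ne'
  rw [h5, this, zero_smul]

/-- The equation defining the spray of the Kropina function. -/
lemma kro_spray_eq (h : (x, y) ∈ cone U H W) (ξ : E) :
    kro1 H W x y (kroSprayReg H W x y + kroSprayProj H W x y • y) * kro1 H W x y ξ
      + kro H W x y * kro2 H W x y (kroSprayReg H W x y + kroSprayProj H W x y • y) ξ =
    (1 / 4) * (dX y (dY ξ (fun x y => kro H W x y ^ 2)) x y
      - dX ξ (fun x y => kro H W x y ^ 2) x y) := by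
  have hw : H x (W x) y ≠ 0 := h.2.ne'
  have hF := (kro_pos hH hW h).ne'
  rw [dX_dY_kro_sq hH hW h, dX_kro_sq hH hW h, dX_kro1 hH hW h, dX_kro hH hW h, dX_kro hH hW h]
  have a1 (v : E) : H x v y = H x y v := hH.symm x h.1 _ _
  have a2 : gam H x ξ y = gam H x y ξ := hH.gam_symm h.1 _ _
  have a3 (v : E) : H x y (covAdj H W x v) = H x v (cov H W x y) := by
    rw [hH.symm x h.1, apply_covAdj hH h.1]
  have a4 : H x (W x) (covAdj H W x y) = H x y (cov H W x (W x)) := by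
    rw [hH.symm x h.1, apply_covAdj hH h.1]
  have a5 : H x (W x) (cov H W x y) = 0 := by
    rw [hH.symm x h.1, hW.apply_cov_self hH h.1]
  have a6 := hW.unit x h.1
  have a7 (v : E) : H x (W x) v = H x v (W x) := hH.symm x h.1 _ _
  have hq := sq_eq_kro hH hW h
  have e : H x y ξ = kro1 H W x y ξ * H x (W x) y + kro H W x y * H x (W x) ξ := by
    rw [kro1]; field_simp; ring
  simp only [kro2, kroSprayReg, kroSprayProj]
  -- Linearity of `dF` reduces both sides to the values of `dF` on the vectors composing the spray;
  -- these are `g1` to `g4`.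
  have k1 (u v : E) : kro1 H W x y (u + v) = kro1 H W x y u + kro1 H W x y v := by
    simp only [kro1, map_add]; ring
  have k2 (u v : E) : kro1 H W x y (u - v) = kro1 H W x y u - kro1 H W x y v := by
    simp only [kro1, map_sub]; ring
  have k3 (c : ℝ) (v : E) : kro1 H W x y (c • v) = c * kro1 H W x y v := by
    simp only [kro1, map_smul, smul_eq_mul]; ring
  have g1 : kro1 H W x y y = kro H W x y := by rw [kro1, hq]; field_simp; ring
  have g2 : kro1 H W x y (W x) = 1 - kro H W x y / H x (W x) y := by
    rw [kro1, a6, ← a1]; field_simp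
  have g3 : kro1 H W x y (cov H W x y) = H x y (cov H W x y) / H x (W x) y := by
    rw [kro1, a5]; ring
  have g4 : kro1 H W x y (covAdj H W x y) = (H x y (cov H W x y)
      - kro H W x y * H x y (cov H W x (W x))) / H x (W x) y := by
    rw [kro1, a3, a4]
  simp only [k1, k2, k3, map_add, map_sub, map_smul, add_apply, sub_apply, smul_apply, smul_eq_mul,
    a2, a4, a5, a6, hq, apply_covAdj hH h.1, g1, g2, g3, g4, a1 (cov H W x (W x)),
    a1 (cov H W x y), a1 (cov H W x ξ)]
  rw [e]
  have e2 (z : E) : H x y z = kro1 H W x y z * H x (W x) y + kro H W x y * H x (W x) z := by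
    rw [kro1]; field_simp; ring
  rw [e2 (gam H x y ξ)]
  field_simp
  ring

end

end Kropina

/-! ### Kropina functions whose wind is a Killing field -/

section KillingKropina

variable {E : Type*} [NormedAddCommGroup E] [NormedSpace ℝ E] [FiniteDimensional ℝ E]
variable {U : Set E} {H : E → E →L[ℝ] E →L[ℝ] ℝ} {W : E → E} {x y : E}

/-- The spray of a Kropina function whose wind is a Killing field. -/
def killingSpray (H : E → E →L[ℝ] E →L[ℝ] ℝ) (W : E → E) (x y : E) : E :=
  (1 / 2 : ℝ) • gam H x y y - kro H W x y • cov H W x y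

variable (hH : IsMetricOn U H) (hW : IsUnitFieldOn U H W)
  (hK : ∀ x ∈ U, ∀ u v, H x (cov H W x u) v = - H x u (cov H W x v))
include hH hW hK

/-- Skewness of `∇W` gives `⟨∇_y W,y⟩ = 0`, which kills the projective part, while the adjoint of
`∇W` is `-∇W` and `∇_W W = 0`. -/
lemma kroSpray_of_killing (hx : x ∈ U) :
    kroSprayReg H W x y + kroSprayProj H W x y • y = killingSpray H W x y := by
  have h1 : covAdj H W x y = - cov H W x y := by
    refine hH.ext hx fun z => ?_
    rw [apply_covAdj hH hx, map_neg, neg_apply, hK x hx, neg_neg]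
  have h2 : H x (cov H W x y) y = 0 := by
    have := hK x hx y y
    rw [hH.symm x hx y] at this
    linarith
  simp only [kroSprayReg, kroSprayProj, killingSpray, h1, h2, hW.cov_field hH hK hx, map_zero,
    zero_apply]
  module

lemma smooth_killingSpray : SmoothPair (cone U H W) (killingSpray H W) :=
  ((((smooth_fst_cone hH hW hH.smooth_gam).clm_apply contDiffOn_snd).clm_apply
    contDiffOn_snd).const_smul (1 / 2 : ℝ)).sub
    ((smooth_kro hH hW).smul ((smooth_fst_cone hH hW (hW.smooth_cov hH)).clm_apply contDiffOn_snd))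

lemma dY_killingSpray (h : (x, y) ∈ cone U H W) (η : E) : dY η (killingSpray H W) x y =
    gam H x y η - kro1 H W x y η • cov H W x y - kro H W x y • cov H W x η := by
  have hy : HasDerivAt (fun t : ℝ => y + t • η) η 0 := by
    simpa using ((hasDerivAt_id (0 : ℝ)).smul_const η).const_add y
  have hF := (smooth_kro hH hW).hasDerivAt_right (isOpen_cone hH hW) h η
  rw [dY_kro hH hW h] at hF
  have hg := (((hasDerivAt_const (0 : ℝ) (gam H x)).clm_apply hy).clm_apply hy).const_smul
    (1 / 2 : ℝ)
  have hB := (hasDerivAt_const (0 : ℝ) (cov H W x)).clm_apply hy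
  refine dY_eq_of_hasDerivAt (isOpen_cone hH hW) (smooth_killingSpray hH hW hK) h
    ((hg.sub (hF.smul hB)).congr_deriv ?_)
  simp only [zero_smul, add_zero, zero_add, zero_apply, hH.gam_symm h.1 η y]
  module

lemma dX_killingSpray (h : (x, y) ∈ cone U H W) (v : E) : dX v (killingSpray H W) x y =
    (1 / 2 : ℝ) • fderiv ℝ (gam H) x v y y - dX v (kro H W) x y • cov H W x y
      - kro H W x y • fderiv ℝ (cov H W) x v y := by
  have hc (a : E) := hasDerivAt_const (0 : ℝ) a
  have hF := (smooth_kro hH hW).hasDerivAt_left (isOpen_cone hH hW) h v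
  have hg := (((hasDerivAt_line hH.isOpen hH.smooth_gam h.1 v).clm_apply (hc y)).clm_apply
    (hc y)).const_smul (1 / 2 : ℝ)
  have hB := (hasDerivAt_line hH.isOpen (hW.smooth_cov hH) h.1 v).clm_apply (hc y)
  refine dX_eq_of_hasDerivAt (isOpen_cone hH hW) (smooth_killingSpray hH hW hK) h
    ((hg.sub (hF.smul hB)).congr_deriv ?_)
  simp only [zero_smul, add_zero, map_zero]
  module

lemma smooth_dY_killingSpray (η : E) : SmoothPair (cone U H W) (fun x y =>
    gam H x y η - kro1 H W x y η • cov H W x y - kro H W x y • cov H W x η) :=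
  ((smooth_killingSpray hH hW hK).dY (isOpen_cone hH hW) η).congr
    fun _ _ h => (dY_killingSpray hH hW hK h η).symm

lemma dY_dY_killingSpray (h : (x, y) ∈ cone U H W) (u η : E) :
    dY u (dY η (killingSpray H W)) x y = gam H x u η - kro2 H W x y u η • cov H W x y
      - kro1 H W x y η • cov H W x u - kro1 H W x y u • cov H W x η := by
  rw [dY_congr (isOpen_cone hH hW) (fun x y h => dY_killingSpray hH hW hK h η) h]
  have hy : HasDerivAt (fun t : ℝ => y + t • u) u 0 := by
    simpa using ((hasDerivAt_id (0 : ℝ)).smul_const u).const_add y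
  have hF := (smooth_kro hH hW).hasDerivAt_right (isOpen_cone hH hW) h u
  rw [dY_kro hH hW h] at hF
  have hF1 := (smooth_kro1 hH hW η).hasDerivAt_right (isOpen_cone hH hW) h u
  rw [dY_kro1 hH hW h] at hF1
  have hg := ((hasDerivAt_const (0 : ℝ) (gam H x)).clm_apply hy).clm_apply
    (hasDerivAt_const (0 : ℝ) η)
  have hB := (hasDerivAt_const (0 : ℝ) (cov H W x)).clm_apply hy
  refine dY_eq_of_hasDerivAt (isOpen_cone hH hW) (smooth_dY_killingSpray hH hW hK η) h
    (((hg.sub (hF1.smul hB)).sub (hF.smul_const (cov H W x η))).congr_deriv ?_)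
  simp only [zero_smul, add_zero, zero_add, zero_apply, map_zero]
  module

lemma dX_dY_killingSpray (h : (x, y) ∈ cone U H W) (v η : E) :
    dX v (dY η (killingSpray H W)) x y = fderiv ℝ (gam H) x v y η
      - dX v (fun x y => kro1 H W x y η) x y • cov H W x y
      - kro1 H W x y η • fderiv ℝ (cov H W) x v y
      - dX v (kro H W) x y • cov H W x η - kro H W x y • fderiv ℝ (cov H W) x v η := by
  rw [dX_congr (isOpen_cone hH hW) (fun x y h => dY_killingSpray hH hW hK h η) h]
  have hc (a : E) := hasDerivAt_const (0 : ℝ) a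
  have hF := (smooth_kro hH hW).hasDerivAt_left (isOpen_cone hH hW) h v
  have hF1 := (smooth_kro1 hH hW η).hasDerivAt_left (isOpen_cone hH hW) h v
  have hg := ((hasDerivAt_line hH.isOpen hH.smooth_gam h.1 v).clm_apply (hc y)).clm_apply (hc η)
  have hB (a : E) := (hasDerivAt_line hH.isOpen (hW.smooth_cov hH) h.1 v).clm_apply (hc a)
  refine dX_eq_of_hasDerivAt (isOpen_cone hH hW) (smooth_dY_killingSpray hH hW hK η) h
    (((hg.sub (hF1.smul (hB y))).sub (hF.smul (hB η))).congr_deriv ?_)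
  simp only [zero_smul, add_zero, map_zero]
  module

/-- The Riemann curvature of a Kropina function whose wind is a Killing field, in terms of the
curvature of the metric. -/
lemma sprayCurvature_killingSpray (h : (x, y) ∈ cone U H W) (η : E) :
    sprayCurvature (killingSpray H W) η x y = riem H x (η - kro1 H W x y η • W x)
      (y - kro H W x y • W x) (y - kro H W x y • W x) := by
  have hw : H x (W x) y ≠ 0 := h.2.ne'
  have hx := h.1
  -- Kostant's formula removes the second derivatives of `W`.
  have dB (u z : E) : fderiv ℝ (cov H W) x u z =
      - riem H x (W x) u z - gam H x u (cov H W x z) + cov H W x (gam H x u z) := by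
    rw [← hW.cov2_eq hH hK hx, cov2]; abel
  have hBB := hW.cov_cov hH hK hx
  have b0 : H x y (cov H W x y) = 0 := by
    have := hK x hx y y
    rw [hH.symm x hx _ y] at this
    linarith
  have b1 (z : E) : H x (W x) (cov H W x z) = 0 := by
    rw [hH.symm x hx, hW.apply_cov_self hH hx]
  have b2 : H x (cov H W x η) y = - H x (cov H W x y) η := by
    rw [hK x hx, hH.symm x hx η]
  have b3 : H x (cov H W x y) y = 0 := by rw [hH.symm x hx, b0]
  have f1 : kro1 H W x y (cov H W x y) = 0 := by rw [kro1, b0, b1]; simp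
  have f2 : kro1 H W x y (cov H W x η) = - H x (cov H W x y) η / H x (W x) y := by
    rw [kro1, b1, hH.symm x hx, b2]; simp
  have f3 : kro2 H W x y (cov H W x y) η = H x (cov H W x y) η / H x (W x) y := by
    rw [kro2, f1, b1]; simp
  have k1 (u v : E) : kro1 H W x y (u + v) = kro1 H W x y u + kro1 H W x y v := by
    simp only [kro1, map_add]; ring
  have k2 (u v : E) : kro1 H W x y (u - v) = kro1 H W x y u - kro1 H W x y v := by
    simp only [kro1, map_sub]; ring
  have k3 (c : ℝ) (v : E) : kro1 H W x y (c • v) = c * kro1 H W x y v := by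
    simp only [kro1, map_smul, smul_eq_mul]; ring
  have m1 (u v : E) : kro2 H W x y (u - v) η = kro2 H W x y u η - kro2 H W x y v η := by
    simp only [kro2, k2, map_sub, sub_apply]; ring
  have m2 (c : ℝ) (v : E) : kro2 H W x y (c • v) η = c * kro2 H W x y v η := by
    simp only [kro2, k3, map_smul, smul_apply, smul_eq_mul]; ring
  have x1 : dX y (kro H W) x y = kro1 H W x y (gam H x y y) := by
    rw [dX_kro hH hW h, b3]; simp
  have x2 : dX η (kro H W) x y = kro1 H W x y (gam H x y η)
      + kro H W x y * (H x (cov H W x y) η / H x (W x) y) := by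
    rw [dX_kro hH hW h, b2, hH.gam_symm hx]; ring
  have x3 : dX y (fun x y => kro1 H W x y η) x y = kro2 H W x y (gam H x y y) η
      + kro1 H W x y (gam H x y η) - kro H W x y * (H x (cov H W x y) η / H x (W x) y) := by
    rw [dX_kro1 hH hW h, x1, b3, kro2, kro1.eq_def H W x y (gam H x y η)]; ring
  -- The derivatives of the Christoffel symbols are traded for curvature; the remaining `∂_y Γ(y,η)`
  -- cancels against the term `dX y (dY η G)`.
  have r1 : fderiv ℝ (gam H) x η y y = riem H x η y y + fderiv ℝ (gam H) x y y η
      - gam H x η (gam H x y y) + gam H x y (gam H x y η) := by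
    rw [riem, hH.fderiv_gam_symm hx y η y, hH.gam_symm hx η y]; abel
  have r2 : riem H x η (W x) y = - riem H x (W x) η y := riem_antisymm _ _ _ _ _
  have r3 : riem H x η (W x) (W x) = - riem H x (W x) η (W x) := riem_antisymm _ _ _ _ _
  have r4 : riem H x η y (W x) = riem H x (W x) y η - riem H x (W x) η y := by
    rw [eq_sub_iff_add_eq, ← sub_eq_zero, riem_antisymm H x (W x) y, sub_neg_eq_add,
      ← hH.bianchi hx η y (W x)]
    abel
  have rW (z : E) : riem H x (W x) (W x) z = 0 := by simp [riem]
  -- Trilinear expansion of the target; with `r2` to `r4` only values of the form `R(η,y)y` and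
  -- `R(W,·)·` remain to be compared.
  have ex : riem H x (η - kro1 H W x y η • W x) (y - kro H W x y • W x) (y - kro H W x y • W x) =
      riem H x η y y - kro H W x y • riem H x η (W x) y - kro H W x y • riem H x η y (W x)
      + kro H W x y ^ 2 • riem H x η (W x) (W x) - kro1 H W x y η • riem H x (W x) y y
      + (kro1 H W x y η * kro H W x y) • riem H x (W x) y (W x)
      + (kro1 H W x y η * kro H W x y) • riem H x (W x) (W x) y
      - (kro1 H W x y η * kro H W x y ^ 2) • riem H x (W x) (W x) (W x) := by
    simp only [riem, map_sub, map_smul, sub_apply, smul_apply]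
    module
  rw [ex, rW, rW, r2, r3, r4]
  simp only [sprayCurvature, dY_dY_killingSpray hH hW hK h, dX_dY_killingSpray hH hW hK h,
    dX_killingSpray hH hW hK h, dY_killingSpray hH hW hK h, dB, x1, x2, x3, r1]
  simp only [killingSpray, k2, k3, m1, m2, f1, f2, f3, map_sub, map_smul, sub_apply,
    smul_apply, hBB, hH.gam_symm hx η y, hH.gam_symm hx (gam H x y y) η,
    hH.gam_symm hx (cov H W x y) η]
  module

end KillingKropina

/-! ### Functions that are polynomial in `y` and `1 / ⟨W, y⟩` -/

section WindRational

variable {E : Type*} [NormedAddCommGroup E] [NormedSpace ℝ E]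
variable {U : Set E} {H : E → E →L[ℝ] E →L[ℝ] ℝ} {W : E → E} {x y : E}

/-- The functions of `(x, y)` that are polynomial in `y` and `1 / ⟨W, y⟩`, with coefficients
depending smoothly on `x`. -/
inductive WindRational (U : Set E) (H : E → E →L[ℝ] E →L[ℝ] ℝ) (W : E → E) :
    (E → E → ℝ) → Prop
  | coeff (c : E → ℝ) (hc : ContDiffOn ℝ ∞ c U) : WindRational U H W fun x _ => c x
  | linear (A : E → E →L[ℝ] ℝ) (hA : ContDiffOn ℝ ∞ A U) : WindRational U H W fun x y => A x y
  | bilinear (A : E → E →L[ℝ] E →L[ℝ] ℝ) (hA : ContDiffOn ℝ ∞ A U) :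
      WindRational U H W fun x y => A x y y
  | inv : WindRational U H W fun x y => (H x (W x) y)⁻¹
  | add {f g : E → E → ℝ} : WindRational U H W f → WindRational U H W g →
      WindRational U H W fun x y => f x y + g x y
  | mul {f g : E → E → ℝ} : WindRational U H W f → WindRational U H W g →
      WindRational U H W fun x y => f x y * g x y
  | congr {f g : E → E → ℝ} : WindRational U H W f →
      (∀ x y, (x, y) ∈ cone U H W → g x y = f x y) → WindRational U H W g

/-- Functions of `t > 0` that are Laurent polynomials. -/
def LaurentPoly (f : ℝ → ℝ) : Prop :=
  ∃ (p : Polynomial ℝ) (k : ℕ), ∀ t : ℝ, 0 < t → f t * t ^ k = p.eval t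

lemma LaurentPoly.const (c : ℝ) : LaurentPoly fun _ => c := ⟨Polynomial.C c, 0, by simp⟩

lemma LaurentPoly.id : LaurentPoly fun t => t := ⟨Polynomial.X, 0, by simp⟩

lemma LaurentPoly.add {f g : ℝ → ℝ} (hf : LaurentPoly f) (hg : LaurentPoly g) :
    LaurentPoly fun t => f t + g t := by
  obtain ⟨p, k, hp⟩ := hf
  obtain ⟨q, l, hq⟩ := hg
  refine ⟨p * Polynomial.X ^ l + q * Polynomial.X ^ k, k + l, fun t ht => ?_⟩
  simp only [Polynomial.eval_add, Polynomial.eval_mul, Polynomial.eval_pow, Polynomial.eval_X,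
    ← hp t ht, ← hq t ht]
  ring

lemma LaurentPoly.mul {f g : ℝ → ℝ} (hf : LaurentPoly f) (hg : LaurentPoly g) :
    LaurentPoly fun t => f t * g t := by
  obtain ⟨p, k, hp⟩ := hf
  obtain ⟨q, l, hq⟩ := hg
  refine ⟨p * q, k + l, fun t ht => ?_⟩
  simp only [Polynomial.eval_mul, ← hp t ht, ← hq t ht]
  ring

lemma LaurentPoly.sub {f g : ℝ → ℝ} (hf : LaurentPoly f) (hg : LaurentPoly g) :
    LaurentPoly fun t => f t - g t := by
  simpa [sub_eq_add_neg] using hf.add ((LaurentPoly.const (-1)).mul hg)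

namespace WindRational

lemma neg {f : E → E → ℝ} (hf : WindRational U H W f) : WindRational U H W fun x y => - f x y :=
  (((WindRational.coeff (fun _ => -1) contDiffOn_const).mul hf)).congr fun _ _ _ => by ring

lemma sub {f g : E → E → ℝ} (hf : WindRational U H W f) (hg : WindRational U H W g) :
    WindRational U H W fun x y => f x y - g x y :=
  (hf.add hg.neg).congr fun _ _ _ => by ring

lemma const_mul {f : E → E → ℝ} (c : ℝ) (hf : WindRational U H W f) :
    WindRational U H W fun x y => c * f x y :=
  (WindRational.coeff (fun _ => c) contDiffOn_const).mul hf

lemma sum {ι : Type*} (s : Finset ι) {f : ι → E → E → ℝ} (hf : ∀ i, WindRational U H W (f i)) :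
    WindRational U H W fun x y => ∑ i ∈ s, f i x y := by
  classical
  induction s using Finset.induction_on with
  | empty => simpa using WindRational.coeff (fun _ => (0 : ℝ)) contDiffOn_const
  | insert a s ha ih => exact ((hf a).add ih).congr fun _ _ _ => Finset.sum_insert ha

/-- Along this line `⟨W,y⟩ = t`, so the generator `inv` becomes `1/t` and the others become
polynomials in `t`. -/
lemma laurentPoly {f : E → E → ℝ} (hf : WindRational U H W f) (hx : x ∈ U) {u b : E}
    (hu : H x (W x) u = 0) (hb : H x (W x) b = 1) : LaurentPoly fun t => f x (u + t • b) := by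
  induction hf with
  | coeff c hc => exact LaurentPoly.const _
  | linear A hA =>
    simpa using (LaurentPoly.const (A x u)).add (LaurentPoly.id.mul (LaurentPoly.const (A x b)))
  | bilinear A hA =>
    have := ((LaurentPoly.const (A x u u)).add (LaurentPoly.id.mul
      (LaurentPoly.const (A x b u + A x u b)))).add
      ((LaurentPoly.id.mul LaurentPoly.id).mul (LaurentPoly.const (A x b b)))
    convert this using 2
    simp
    ring
  | inv =>
    refine ⟨1, 1, fun t ht => ?_⟩
    simp [hu, hb, ht.ne']
  | add _ _ ihf ihg => exact ihf.add ihg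
  | mul _ _ ihf ihg => exact ihf.mul ihg
  | congr _ hfg ih =>
    obtain ⟨p, k, hp⟩ := ih
    refine ⟨p, k, fun t ht => ?_⟩
    have h : (x, u + t • b) ∈ cone U H W := ⟨hx, by simpa [hu, hb] using ht⟩
    simpa only [hfg _ _ h] using hp t ht

section

variable [FiniteDimensional ℝ E] (hH : IsMetricOn U H) (hW : IsUnitFieldOn U H W)
include hH hW

lemma smoothPair {f : E → E → ℝ} (hf : WindRational U H W f) : SmoothPair (cone U H W) f := by
  induction hf with
  | coeff c hc => exact smooth_fst_cone hH hW hc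
  | linear A hA => exact (smooth_fst_cone hH hW hA).clm_apply contDiffOn_snd
  | bilinear A hA =>
    exact ((smooth_fst_cone hH hW hA).clm_apply contDiffOn_snd).clm_apply contDiffOn_snd
  | inv => exact ContDiffOn.inv (smooth_wind hH hW) fun _ hp => hp.2.ne'
  | add _ _ ihf ihg => exact ContDiffOn.add ihf ihg
  | mul _ _ ihf ihg => exact ContDiffOn.mul ihf ihg
  | congr _ hfg ih => exact SmoothPair.congr ih hfg

lemma wind : WindRational U H W fun x y => H x (W x) y :=
  .linear _ (hH.smooth.clm_apply hW.smooth)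

/-- Separate from the induction below because the `inv` case also needs it, for the linear function
`⟨W,y⟩`. -/
lemma dX_linear {A : E → E →L[ℝ] ℝ} (hA : ContDiffOn ℝ ∞ A U) (v : E) :
    WindRational U H W (dX v fun x y => A x y) := by
  refine (WindRational.linear (fun x => fderiv ℝ A x v)
    ((contDiffOn_fderiv hH.isOpen hA).clm_apply contDiffOn_const)).congr fun x y h => ?_
  refine dX_eq_of_hasDerivAt (isOpen_cone hH hW) ((WindRational.linear A hA).smoothPair hH hW) h
    (((hasDerivAt_line hH.isOpen hA h.1 v).clm_apply (hasDerivAt_const (0 : ℝ) y)).congr_deriv ?_)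
  simp

lemma dY_linear {A : E → E →L[ℝ] ℝ} (hA : ContDiffOn ℝ ∞ A U) (v : E) :
    WindRational U H W (dY v fun x y => A x y) := by
  refine (WindRational.coeff (fun x => A x v) (hA.clm_apply contDiffOn_const)).congr
    fun x y h => ?_
  simp [dY]

protected lemma dX {f : E → E → ℝ} (hf : WindRational U H W f) (v : E) :
    WindRational U H W (dX v f) := by
  have hΩ := isOpen_cone hH hW
  induction hf with
  | coeff c hc =>
    exact .coeff (fun x => fderiv ℝ c x v)
      ((contDiffOn_fderiv hH.isOpen hc).clm_apply contDiffOn_const)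
  | linear A hA => exact dX_linear hH hW hA v
  | bilinear A hA =>
    refine (WindRational.bilinear (fun x => fderiv ℝ A x v)
      ((contDiffOn_fderiv hH.isOpen hA).clm_apply contDiffOn_const)).congr fun x y h => ?_
    have hc := hasDerivAt_const (0 : ℝ) y
    refine dX_eq_of_hasDerivAt hΩ ((WindRational.bilinear A hA).smoothPair hH hW) h
      ((((hasDerivAt_line hH.isOpen hA h.1 v).clm_apply hc).clm_apply hc).congr_deriv ?_)
    simp
  | inv =>
    refine ((dX_linear hH hW (hH.smooth.clm_apply hW.smooth) v).mul
      (inv.mul inv)).neg.congr fun x y h => ?_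
    have hd := (smooth_wind hH hW).hasDerivAt_left hΩ h v
    have hw : H x (W x) y ≠ 0 := h.2.ne'
    refine dX_eq_of_hasDerivAt hΩ (inv.smoothPair hH hW) h
      ((hd.fun_inv (by simpa using hw)).congr_deriv ?_)
    simp only [zero_smul, add_zero]
    field_simp
  | @add f g hf hg ihf ihg =>
    exact (ihf.add ihg).congr fun x y h =>
      dX_add hΩ (hf.smoothPair hH hW) (hg.smoothPair hH hW) h v
  | @mul f g hf hg ihf ihg =>
    exact ((hf.mul ihg).add (ihf.mul hg)).congr fun x y h =>
      dX_smul hΩ (hf.smoothPair hH hW) (hg.smoothPair hH hW) h v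
  | congr _ hfg ih => exact ih.congr fun x y h => dX_congr hΩ hfg h v

protected lemma dY {f : E → E → ℝ} (hf : WindRational U H W f) (v : E) :
    WindRational U H W (dY v f) := by
  have hΩ := isOpen_cone hH hW
  induction hf with
  | coeff c hc =>
    refine (WindRational.coeff (fun _ => 0) contDiffOn_const).congr fun x y h => ?_
    simp [dY]
  | linear A hA => exact dY_linear hH hW hA v
  | bilinear A hA =>
    refine ((WindRational.linear (fun x => A x v) (hA.clm_apply contDiffOn_const)).add
      (WindRational.linear (fun x => (A x).flip v)
      (((ContinuousLinearMap.flipₗᵢ ℝ E E ℝ).contDiff.comp_contDiffOn hA).clm_apply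
        contDiffOn_const))).congr fun x y h => ?_
    have hy : HasDerivAt (fun t : ℝ => y + t • v) v 0 := by
      simpa using ((hasDerivAt_id (0 : ℝ)).smul_const v).const_add y
    refine dY_eq_of_hasDerivAt hΩ ((WindRational.bilinear A hA).smoothPair hH hW) h
      ((((hasDerivAt_const (0 : ℝ) (A x)).clm_apply hy).clm_apply hy).congr_deriv ?_)
    simp
  | inv =>
    refine ((dY_linear hH hW (hH.smooth.clm_apply hW.smooth) v).mul
      (inv.mul inv)).neg.congr fun x y h => ?_
    have hd := (smooth_wind hH hW).hasDerivAt_right hΩ h v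
    have hw : H x (W x) y ≠ 0 := h.2.ne'
    refine dY_eq_of_hasDerivAt hΩ (inv.smoothPair hH hW) h
      ((hd.fun_inv (by simpa using hw)).congr_deriv ?_)
    simp only [zero_smul, add_zero]
    field_simp
  | @add f g hf hg ihf ihg =>
    exact (ihf.add ihg).congr fun x y h =>
      dY_add hΩ (hf.smoothPair hH hW) (hg.smoothPair hH hW) h v
  | @mul f g hf hg ihf ihg =>
    exact ((hf.mul ihg).add (ihf.mul hg)).congr fun x y h =>
      dY_smul hΩ (hf.smoothPair hH hW) (hg.smoothPair hH hW) h v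
  | congr _ hfg ih => exact ih.congr fun x y h => dY_congr hΩ hfg h v

end

end WindRational

/-- Vector valued functions all of whose components are `WindRational`. -/
structure WindRationalVec (U : Set E) (H : E → E →L[ℝ] E →L[ℝ] ℝ) (W : E → E)
    (G : E → E → E) : Prop where
  smooth : SmoothPair (cone U H W) G
  pair : ∀ A : E → E →L[ℝ] ℝ, ContDiffOn ℝ ∞ A U → WindRational U H W fun x y => A x (G x y)

namespace WindRationalVec

variable [FiniteDimensional ℝ E] (hH : IsMetricOn U H) (hW : IsUnitFieldOn U H W)
include hH hW

lemma add {G D : E → E → E} (hG : WindRationalVec U H W G) (hD : WindRationalVec U H W D) :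
    WindRationalVec U H W fun x y => G x y + D x y :=
  ⟨ContDiffOn.add hG.smooth hD.smooth, fun A hA =>
    ((hG.pair A hA).add (hD.pair A hA)).congr fun _ _ _ => map_add _ _ _⟩

lemma smul {c : E → E → ℝ} {D : E → E → E} (hc : WindRational U H W c)
    (hD : WindRationalVec U H W D) : WindRationalVec U H W fun x y => c x y • D x y :=
  ⟨ContDiffOn.smul (hc.smoothPair hH hW) hD.smooth, fun A hA =>
    (hc.mul (hD.pair A hA)).congr fun _ _ _ => map_smul _ _ _⟩

lemma const_smul (c : ℝ) {D : E → E → E} (hD : WindRationalVec U H W D) :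
    WindRationalVec U H W fun x y => c • D x y :=
  smul hH hW (.coeff (fun _ => c) contDiffOn_const) hD

lemma sub {G D : E → E → E} (hG : WindRationalVec U H W G) (hD : WindRationalVec U H W D) :
    WindRationalVec U H W fun x y => G x y - D x y := by
  simpa [sub_eq_add_neg] using add hH hW hG (const_smul hH hW (-1) hD)

lemma linear {B : E → E →L[ℝ] E} (hB : ContDiffOn ℝ ∞ B U) :
    WindRationalVec U H W fun x y => B x y :=
  ⟨(smooth_fst_cone hH hW hB).clm_apply contDiffOn_snd, fun A hA =>
    .linear (fun x => (A x).comp (B x)) (hA.clm_comp hB)⟩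

lemma coeff {B : E → E} (hB : ContDiffOn ℝ ∞ B U) : WindRationalVec U H W fun x _ => B x :=
  ⟨smooth_fst_cone hH hW hB, fun A hA => .coeff (fun x => A x (B x)) (hA.clm_apply hB)⟩

/-- Leibniz rule for a covector that moves with `x`: `A(∂_v G) = ∂_v(A G) - (∂_v A) G`. -/
protected lemma dX {G : E → E → E} (hG : WindRationalVec U H W G) (v : E) :
    WindRationalVec U H W (dX v G) := by
  have hΩ := isOpen_cone hH hW
  refine ⟨hG.smooth.dX hΩ v, fun A hA => ?_⟩
  refine (((hG.pair A hA).dX hH hW v).sub (hG.pair (fun x => fderiv ℝ A x v)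
    ((contDiffOn_fderiv hH.isOpen hA).clm_apply contDiffOn_const))).congr fun x y h => ?_
  rw [eq_sub_iff_add_eq]
  refine (dX_eq_of_hasDerivAt hΩ ((hG.pair A hA).smoothPair hH hW) h
    (((hasDerivAt_line hH.isOpen hA h.1 v).clm_apply
      (hG.smooth.hasDerivAt_left hΩ h v)).congr_deriv ?_)).symm
  simp [add_comm]

protected lemma dY {G : E → E → E} (hG : WindRationalVec U H W G) (v : E) :
    WindRationalVec U H W (dY v G) := by
  have hΩ := isOpen_cone hH hW
  refine ⟨hG.smooth.dY hΩ v, fun A hA => ?_⟩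
  refine ((hG.pair A hA).dY hH hW v).congr fun x y h => ?_
  refine (dY_eq_of_hasDerivAt hΩ ((hG.pair A hA).smoothPair hH hW) h
    (((hasDerivAt_const (0 : ℝ) (A x)).clm_apply
      (hG.smooth.hasDerivAt_right hΩ h v)).congr_deriv ?_)).symm
  simp

lemma coord {D : E → E → E} (hD : WindRationalVec U H W D) (i : Fin (Module.finrank ℝ E)) :
    WindRational U H W fun x y => (Module.finBasis ℝ E).coord i (D x y) :=
  hD.pair (fun _ => LinearMap.toContinuousLinearMap ((Module.finBasis ℝ E).coord i))
    contDiffOn_const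

/-- The direction depends on `(x, y)`; expanding it in a fixed basis reduces to constant directions.
-/
lemma dX_scalar {D : E → E → E} (hD : WindRationalVec U H W D) {f : E → E → ℝ}
    (hf : WindRational U H W f) : WindRational U H W fun x y => dX (D x y) f x y := by
  refine (WindRational.sum Finset.univ fun i => (coord hH hW hD i).mul
    (hf.dX hH hW (Module.finBasis ℝ E i))).congr fun x y h => ?_
  conv_lhs => rw [← (Module.finBasis ℝ E).sum_repr (D x y)]
  simp only [dX_sum_dir, dX_smul_dir, smul_eq_mul, Module.Basis.coord_apply]

lemma dY_scalar {D : E → E → E} (hD : WindRationalVec U H W D) {f : E → E → ℝ}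
    (hf : WindRational U H W f) : WindRational U H W fun x y => dY (D x y) f x y := by
  refine (WindRational.sum Finset.univ fun i => (coord hH hW hD i).mul
    (hf.dY hH hW (Module.finBasis ℝ E i))).congr fun x y h => ?_
  conv_lhs => rw [← (Module.finBasis ℝ E).sum_repr (D x y)]
  simp only [dY_sum_dir, dY_smul_dir, smul_eq_mul, Module.Basis.coord_apply]

lemma dX_pair {D G : E → E → E} (hD : WindRationalVec U H W D) (hG : WindRationalVec U H W G)
    {A : E → E →L[ℝ] ℝ} (hA : ContDiffOn ℝ ∞ A U) :
    WindRational U H W fun x y => A x (dX (D x y) G x y) := by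
  refine (WindRational.sum Finset.univ fun i => (coord hH hW hD i).mul
    ((WindRationalVec.dX hH hW hG (Module.finBasis ℝ E i)).pair A hA)).congr fun x y h => ?_
  conv_lhs => rw [← (Module.finBasis ℝ E).sum_repr (D x y)]
  simp only [dX_sum_dir, dX_smul_dir, map_sum, map_smul, smul_eq_mul, Module.Basis.coord_apply]

lemma dY_pair {D G : E → E → E} (hD : WindRationalVec U H W D) (hG : WindRationalVec U H W G)
    {A : E → E →L[ℝ] ℝ} (hA : ContDiffOn ℝ ∞ A U) :
    WindRational U H W fun x y => A x (dY (D x y) G x y) := by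
  refine (WindRational.sum Finset.univ fun i => (coord hH hW hD i).mul
    ((WindRationalVec.dY hH hW hG (Module.finBasis ℝ E i)).pair A hA)).congr fun x y h => ?_
  conv_lhs => rw [← (Module.finBasis ℝ E).sum_repr (D x y)]
  simp only [dY_sum_dir, dY_smul_dir, map_sum, map_smul, smul_eq_mul, Module.Basis.coord_apply]

lemma id : WindRationalVec U H W fun _ y => y :=
  linear hH hW (B := fun _ => ContinuousLinearMap.id ℝ E) contDiffOn_const

/-- Applied to the regular part of the spray: its curvature contributes no denominator `⟨y,y⟩`. -/
lemma sprayCurvature_pair {G : E → E → E} (hG : WindRationalVec U H W G) (η : E)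
    {A : E → E →L[ℝ] ℝ} (hA : ContDiffOn ℝ ∞ A U) :
    WindRational U H W fun x y => A x (sprayCurvature G η x y) := by
  have hη := WindRationalVec.dY hH hW hG η
  have h1 := (((WindRationalVec.dX hH hW hG η).pair A hA).const_mul 2).sub
    (dX_pair hH hW (id hH hW) hη hA)
  have h2 := (h1.add ((dY_pair hH hW hG hη hA).const_mul 2)).sub (dY_pair hH hW hη hG hA)
  refine h2.congr fun x y h => ?_
  simp [sprayCurvature]

end WindRationalVec

end WindRational

/-! ### Constant flag curvature forces the wind to be a Killing field -/

section ConstantFlagCurvature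

/-- After clearing powers of `t` this is an identity of real polynomials, since it holds at
infinitely many points. At `t = i` the right side vanishes while the power of `t` does not, so `a +
c i = 0` with `a` and `c` real. -/
lemma eq_zero_of_sq_eq_one_add_sq_mul {a c : ℝ} {g : ℝ → ℝ} (hg : LaurentPoly g)
    (h : ∀ t : ℝ, 0 < t → (a + c * t) ^ 2 * t ^ 3 = (1 + t ^ 2) * g t) : a = 0 ∧ c = 0 := by
  obtain ⟨p, k, hp⟩ := hg
  have key : (Polynomial.C a + Polynomial.C c * Polynomial.X) ^ 2 * Polynomial.X ^ (3 + k) =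
      (1 + Polynomial.X ^ 2) * p := by
    refine Polynomial.eq_of_infinite_eval_eq _ _ ((Set.Ioi_infinite (0 : ℝ)).mono fun t ht => ?_)
    have := hp t ht
    simp only [Set.mem_ofPred_eq, Polynomial.eval_mul, Polynomial.eval_pow, Polynomial.eval_add,
      Polynomial.eval_C, Polynomial.eval_X, Polynomial.eval_one, ← this]
    rw [pow_add, ← mul_assoc, h t ht]
    ring
  have h1 := congrArg (Polynomial.aeval Complex.I) key
  simp only [map_mul, map_pow, map_add, Polynomial.aeval_C, Polynomial.aeval_X, map_one,
    Complex.I_sq, add_neg_cancel, zero_mul, Complex.coe_algebraMap] at h1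
  have h2 : (a : ℂ) + c * Complex.I = 0 := by
    rcases mul_eq_zero.1 h1 with h | h
    · exact pow_eq_zero_iff two_ne_zero |>.1 h
    · exact absurd h (pow_ne_zero _ Complex.I_ne_zero)
  constructor
  · simpa using congrArg Complex.re h2
  · simpa using congrArg Complex.im h2

variable {E : Type*} [NormedAddCommGroup E] [NormedSpace ℝ E] [FiniteDimensional ℝ E]
variable {U : Set E} {H : E → E →L[ℝ] E →L[ℝ] ℝ} {W : E → E} {x y : E}
variable (hH : IsMetricOn U H) (hW : IsUnitFieldOn U H W)
include hH hW

lemma windRational_sq : WindRational U H W fun x y => H x y y := .bilinear H hH.smooth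

lemma windRational_kro : WindRational U H W (kro H W) :=
  ((windRational_sq hH hW).mul (.const_mul (1 / 2) .inv)).congr fun x y h => by
    have : H x (W x) y ≠ 0 := h.2.ne'
    rw [kro]; field_simp

lemma windRational_cov : WindRational U H W fun x y => H x (cov H W x y) y :=
  .bilinear (fun x => (H x).comp (cov H W x)) (hH.smooth.clm_comp (hW.smooth_cov hH))

lemma windRational_cov_wind : WindRational U H W fun x y => H x (cov H W x (W x)) y :=
  .linear (fun x => H x (cov H W x (W x)))
    (hH.smooth.clm_apply ((hW.smooth_cov hH).clm_apply hW.smooth))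

lemma smooth_covAdj : ContDiffOn ℝ ∞ (covAdj H W) U := by
  refine hH.smooth_sharp.clm_comp (ContDiffOn.clm_comp ?_ hH.smooth)
  exact (ContinuousLinearMap.contDiff _).comp_contDiffOn (hW.smooth_cov hH)

lemma windRationalVec_gam : WindRationalVec U H W fun x y => gam H x y y :=
  ⟨((smooth_fst_cone hH hW hH.smooth_gam).clm_apply contDiffOn_snd).clm_apply contDiffOn_snd,
    fun A hA => .bilinear (fun x => (ContinuousLinearMap.compL ℝ E E ℝ (A x)).comp (gam H x))
      (((ContinuousLinearMap.contDiff _).comp_contDiffOn hA).clm_comp hH.smooth_gam)⟩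

lemma windRationalVec_kroSprayReg : WindRationalVec U H W (kroSprayReg H W) := by
  have hv := windRational_cov_wind hH hW
  have h1 := WindRationalVec.const_smul hH hW (1 / 2) (windRationalVec_gam hH hW)
  have h2 := WindRationalVec.smul hH hW ((windRational_kro hH hW).const_mul (1 / 2))
    (WindRationalVec.sub hH hW (WindRationalVec.linear hH hW (hW.smooth_cov hH))
      (WindRationalVec.linear hH hW (smooth_covAdj hH hW)))
  have h3 := WindRationalVec.smul hH hW (((windRational_cov hH hW).const_mul (1 / 2)).sub
    (((windRational_kro hH hW).mul hv).const_mul (1 / 2)))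
    (WindRationalVec.coeff hH hW hW.smooth)
  have h4 := WindRationalVec.smul hH hW (hv.const_mul (1 / 2)) (WindRationalVec.id hH hW)
  convert WindRationalVec.add hH hW (WindRationalVec.add hH hW
    (WindRationalVec.sub hH hW h1 h2) h3) h4 using 3
  simp only [kroSprayReg]
  module

lemma smooth_kroSprayProj : SmoothPair (cone U H W) (kroSprayProj H W) :=
  ContDiffOn.div (ContDiffOn.neg (((windRational_cov hH hW).mul
    (WindRational.wind hH hW)).smoothPair hH hW)) (smooth_sq hH hW)
    fun _ hp => (sq_pos_of_mem_cone hH hW hp).ne'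

lemma dY_self_of_homogeneous {V : Type*} [NormedAddCommGroup V] [NormedSpace ℝ V]
    {f : E → E → V} (hf : SmoothPair (cone U H W) f) (k : ℕ)
    (hom : ∀ x y : E, ∀ t : ℝ, 0 < t → f x (t • y) = t ^ k • f x y) (h : (x, y) ∈ cone U H W) :
    dY y f x y = (k : ℝ) • f x y := by
  refine dY_eq_of_hasDerivAt (isOpen_cone hH hW) hf h ?_
  have h1 : HasDerivAt (fun t : ℝ => (1 + t) ^ k • f x y) ((k : ℝ) • f x y) 0 := by
    have := (((hasDerivAt_id (0 : ℝ)).const_add 1).pow k).smul_const (f x y)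
    simpa using this
  refine h1.congr_of_eventuallyEq ?_
  -- Homogeneity is available only for positive factors `1 + t`; it suffices near `t = 0`.
  filter_upwards [Ioi_mem_nhds (show (-1 : ℝ) < 0 by norm_num)] with t ht
  have ht' : 0 < 1 + t := by have : -1 < t := ht; linarith
  rw [← hom x y _ ht', add_smul, one_smul]

lemma dY_sq (h : (x, y) ∈ cone U H W) (v : E) : dY v (fun x y => H x y y) x y = 2 * H x v y := by
  have hy : HasDerivAt (fun t : ℝ => y + t • v) v 0 := by
    simpa using ((hasDerivAt_id (0 : ℝ)).smul_const v).const_add y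
  refine dY_eq_of_hasDerivAt (isOpen_cone hH hW) (smooth_sq hH hW) h
    ((((hasDerivAt_const (0 : ℝ) (H x)).clm_apply hy).clm_apply hy).congr_deriv ?_)
  simp only [zero_smul, add_zero, zero_add, zero_apply, hH.symm x h.1 y v]
  ring

lemma dX_sq (h : (x, y) ∈ cone U H W) (v : E) :
    dX v (fun x y => H x y y) x y = 2 * H x (gam H x v y) y := by
  have hc := hasDerivAt_const (0 : ℝ) y
  refine dX_eq_of_hasDerivAt (isOpen_cone hH hW) (smooth_sq hH hW) h
    ((((hasDerivAt_line hH.isOpen hH.smooth h.1 v).clm_apply hc).clm_apply hc).congr_deriv ?_)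
  simp only [zero_smul, add_zero, map_zero, zero_apply, hH.compat h.1, hH.symm x h.1 y]
  ring

/-- Governs the derivative of `⟨y,y⟩` along the regular spray. Modulo `⟨y,y⟩` the non-Christoffel
part is twice `⟨∇_y W,y⟩⟨W,y⟩`, minus twice the numerator of `P`. -/
lemma apply_kroSprayReg (h : (x, y) ∈ cone U H W) : 4 * H x (kroSprayReg H W x y) y =
    2 * H x (gam H x y y) y + 2 * (H x (cov H W x y) y * H x (W x) y)
      + H x (cov H W x (W x)) y * H x y y := by
  have hw : H x (W x) y ≠ 0 := h.2.ne'
  have h1 : H x (covAdj H W x y) y = H x (cov H W x y) y := by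
    rw [apply_covAdj hH h.1, hH.symm x h.1]
  simp only [kroSprayReg, map_add, map_sub, map_smul, add_apply, sub_apply, smul_apply,
    smul_eq_mul, h1, kro]
  field_simp
  ring

/-- The term with the highest power of `⟨y, y⟩` in the denominator of the curvature. -/
lemma exists_projective_term : ∃ ρ : E → E → ℝ, WindRational U H W ρ ∧
    ∀ x y, (x, y) ∈ cone U H W →
      (kroSprayProj H W x y ^ 2 + 2 * dY (kroSprayReg H W x y) (kroSprayProj H W) x y
        - dX y (kroSprayProj H W) x y) * H x y y ^ 2 =
      3 * (H x (cov H W x y) y * H x (W x) y) ^ 2 + H x y y * ρ x y := by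
  set N : E → E → ℝ := fun x y => - (H x (cov H W x y) y * H x (W x) y) with hN
  have hNr : WindRational U H W N := ((windRational_cov hH hW).mul (WindRational.wind hH hW)).neg
  have hΩ := isOpen_cone hH hW
  refine ⟨fun x y => 2 * dY (kroSprayReg H W x y) N x y - dX y N x y
    - N x y * H x (cov H W x (W x)) y, ?_, fun x y h => ?_⟩
  · exact ((((windRationalVec_kroSprayReg hH hW).dY_scalar hH hW hNr).const_mul 2).sub
      ((WindRationalVec.id hH hW).dX_scalar hH hW hNr)).sub
      (hNr.mul (windRational_cov_wind hH hW))
  · have hq : H x y y ≠ 0 := (sq_pos_of_mem_cone hH hW h).ne'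
    have hY (v : E) : dY v (kroSprayProj H W) x y =
        (dY v N x y * H x y y - N x y * (2 * H x v y)) / H x y y ^ 2 := by
      have h1 := (hNr.smoothPair hH hW).hasDerivAt_right hΩ h v
      have h2 := (smooth_sq hH hW).hasDerivAt_right hΩ h v
      rw [dY_sq hH hW h] at h2
      refine dY_eq_of_hasDerivAt hΩ (smooth_kroSprayProj hH hW) h
        ((h1.div h2 (by simpa using hq)).congr_deriv ?_)
      simp only [zero_smul, add_zero]
    have hX (v : E) : dX v (kroSprayProj H W) x y =
        (dX v N x y * H x y y - N x y * (2 * H x (gam H x v y) y)) / H x y y ^ 2 := by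
      have h1 := (hNr.smoothPair hH hW).hasDerivAt_left hΩ h v
      have h2 := (smooth_sq hH hW).hasDerivAt_left hΩ h v
      rw [dX_sq hH hW h] at h2
      refine dX_eq_of_hasDerivAt hΩ (smooth_kroSprayProj hH hW) h
        ((h1.div h2 (by simpa using hq)).congr_deriv ?_)
      simp only [zero_smul, add_zero]
    have hP : kroSprayProj H W x y = N x y / H x y y := rfl
    have hG := apply_kroSprayReg hH hW h
    have hNe : H x (cov H W x y) y * H x (W x) y = - N x y := by simp [hN]
    rw [hNe] at hG ⊢
    rw [hY, hX, hP]
    field_simp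
    -- The factor 3 is `1 + 2`: one `N²` from `P²`, and two from differentiating the denominator, by
    -- `apply_kroSprayReg`; there the Christoffel terms cancel.
    linear_combination (-N x y) * hG

/-- If the Riemann curvature of the Kropina function is that of constant flag curvature, then the
wind is a Killing field. -/
theorem killing_of_constant_curvature {K : ℝ}
    (hC : ∀ x y, (x, y) ∈ cone U H W → ∀ η : E, ∃ c : ℝ,
      sprayCurvature (fun x y => kroSprayReg H W x y + kroSprayProj H W x y • y) η x y =
        (K * kro H W x y ^ 2) • η + c • y) :
    ∀ x ∈ U, ∀ u v, H x (cov H W x u) v = - H x u (cov H W x v) := by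
  intro x hx
  obtain ⟨ρ, hρ, hE⟩ := exists_projective_term hH hW
  have hG := windRationalVec_kroSprayReg hH hW
  have hB (v : E) : H x (cov H W x v) (W x) = 0 := hW.apply_cov_self hH hx v
  have main (u : E) (hu : H x (W x) u = 0) (hu1 : H x u u = 1) :
      H x (cov H W x u) u = 0 ∧ H x (cov H W x (W x)) u = 0 := by
    have hb := hW.unit x hx
    have hmem (t : ℝ) (ht : 0 < t) : (x, u + t • W x) ∈ cone U H W :=
      ⟨hx, by simpa [hu, hb] using ht⟩
    have lp {f : E → E → ℝ} (hf : WindRational U H W f) :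
        LaurentPoly fun t => f x (u + t • W x) := hf.laurentPoly hx hu hb
    have L1 := lp (hG.sprayCurvature_pair hH hW u (A := fun x => H x u)
      (hH.smooth.clm_apply contDiffOn_const))
    have L2 := lp (hG.sprayCurvature_pair hH hW u (A := fun x => H x (W x))
      (hH.smooth.clm_apply hW.smooth))
    have LF := lp (windRational_kro hH hW)
    have Lq := lp (windRational_sq hH hW)
    have Lρ := lp hρ
    have Lt := LaurentPoly.id
    -- The cofactor `g(t)` in `(a + c t)² t³ = (1 + t²) g(t)`, found by solving the curvature
    -- equation for its leading term.
    have L := (LaurentPoly.const (1 / 3)).mul (((((LaurentPoly.const K).mul (LF.mul LF)).mul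
      (Lt.mul Lq)).sub (((Lt.mul L1).sub L2).mul Lq)).sub (Lt.mul Lρ))
    refine eq_zero_of_sq_eq_one_add_sq_mul L fun t ht => ?_
    have h := hmem t ht
    set y := u + t • W x with hy
    have hq : H x y y = 1 + t ^ 2 := by
      simp only [hy, map_add, map_smul, add_apply, smul_apply, smul_eq_mul, hu1, hb,
        hH.symm x hx u, hu]
      ring
    have hw : H x (W x) y = t := by simp [hy, hu, hb]
    have hr : H x (cov H W x y) y =
        H x (cov H W x u) u + H x (cov H W x (W x)) u * t := by
      simp only [hy, map_add, map_smul, add_apply, smul_apply, smul_eq_mul, hB]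
      ring
    obtain ⟨c, hc⟩ := hC x y h u
    obtain ⟨c', hc'⟩ := sprayCurvature_projective (isOpen_cone hH hW) hG.smooth
      (smooth_kroSprayProj hH hW)
      (fun x y h => by
        simpa using dY_self_of_homogeneous hH hW hG.smooth 2
          (fun x y t ht => kroSprayReg_smul ht) h)
      (fun x y h => by
        simpa using dY_self_of_homogeneous hH hW (smooth_kroSprayProj hH hW) 1
          (fun x y t ht => by simpa using kroSprayProj_smul ht) h) h u
    rw [hc] at hc'
    -- The functional `t⟨u,·⟩ - ⟨W,·⟩` kills `y = u + t W`, so both unknown multiples of `y` drop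
    -- out. Its value at `u` is `t`, which raises `⟨W,y⟩² = t²` to `t³`.
    have e1 := congrArg (fun z => t * H x u z - H x (W x) z) hc'
    have huy : H x u y = 1 := by simp [hy, hu1, hH.symm x hx u, hu]
    simp only [map_add, map_smul, smul_eq_mul, hu, hu1, hw, huy] at e1
    have e2 := hE x y h
    rw [hw, hr] at e2
    simp only [hq] at e2 ⊢
    linear_combination (-(1 / 3) * (1 + t ^ 2) ^ 2) * e1 - (1 / 3) * t * e2
  have hquad (u : E) : H x (cov H W x u) u = 0 := by
    -- Orthogonal splitting along `W`: since `⟨∇_v W,W⟩ = 0`, only `⟨∇_z W,z⟩` and `⟨∇_W W,z⟩`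
    -- survive, and `main` kills both once `z` is normalised.
    set z := u - H x (W x) u • W x with hz
    have hzW : H x (W x) z = 0 := by simp [hz, hW.unit x hx]
    have hu : u = z + H x (W x) u • W x := by simp [hz]
    have hz2 : H x (cov H W x z) z = 0 ∧ H x (cov H W x (W x)) z = 0 := by
      by_cases h0 : z = 0
      · simp [h0]
      · have hp := hH.pos x hx z h0
        have hs : √(H x z z) ≠ 0 := (Real.sqrt_pos.2 hp).ne'
        obtain ⟨h1, h2⟩ := main ((√(H x z z))⁻¹ • z) (by simp [hzW]) (by
          simp only [map_smul, smul_apply, smul_eq_mul]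
          rw [← mul_assoc, ← mul_inv, Real.mul_self_sqrt hp.le, inv_mul_cancel₀ hp.ne'])
        simpa [hs] using And.intro h1 h2
    rw [hu]
    simp [hz2.1, hz2.2, hB]
  intro u v
  -- Polarisation of the vanishing quadratic form.
  have := hquad (u + v)
  simp only [map_add, add_apply, hquad, hH.symm x hx] at this
  rw [hH.symm x hx u]
  have h1 := hH.symm x hx (cov H W x u) v
  have h2 := hH.symm x hx (cov H W x v) u
  linarith

end ConstantFlagCurvature

/-! ### Index notation -/

section Index

variable {n : ℕ}

lemma sum_coordVec (v : Rn n) : ∑ i, v i • coordVec i = v := by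
  ext j
  simp [coordVec, Pi.single_apply]

lemma sum_apply_coordVec {V : Type*} [AddCommGroup V] [Module ℝ V] [TopologicalSpace V]
    (A : Rn n →L[ℝ] V) (v : Rn n) : ∑ i, v i • A (coordVec i) = A v := by
  conv_rhs => rw [← sum_coordVec v]
  simp only [map_sum, map_smul]

/-- Evaluates `A⁻¹ b` by exhibiting a solution of `A v = b`. The trivial kernel excludes the
singular case, in which `A⁻¹` would be the default value zero. -/
lemma inv_mul_sum {A : Matrix (Fin n) (Fin n) ℝ} (hA : ∀ v : Rn n, (∀ i, ∑ j, A i j * v j = 0) →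
    v = 0) {v : Rn n} {b : Fin n → ℝ} (hb : ∀ i, ∑ j, A i j * v j = b i) (i : Fin n) :
    ∑ l, A⁻¹ i l * b l = v i := by
  have hdet : A.det ≠ 0 := by
    intro h
    obtain ⟨w, hw0, hw⟩ := Matrix.exists_mulVec_eq_zero_iff.2 h
    apply hw0
    have := hA (WithLp.toLp 2 w) fun i => by simpa [Matrix.mulVec, dotProduct] using congrFun hw i
    simpa using congrArg (WithLp.ofLp (p := 2)) this
  have h1 : A.mulVec (WithLp.ofLp v) = b := funext fun i => by
    simpa [Matrix.mulVec, dotProduct] using hb i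
  have h2 : A⁻¹.mulVec b = WithLp.ofLp v := by
    rw [← h1, Matrix.mulVec_mulVec, Matrix.nonsing_inv_mul _ (isUnit_iff_ne_zero.2 hdet),
      Matrix.one_mulVec]
  simpa [Matrix.mulVec, dotProduct] using congrFun h2 i

/-- The bilinear form with given coefficients. -/
def metricForm (g : Rn n → Matrix (Fin n) (Fin n) ℝ) (x : Rn n) : Rn n →L[ℝ] Rn n →L[ℝ] ℝ :=
  ∑ i, ∑ j, g x i j •
    (EuclideanSpace.proj i : Rn n →L[ℝ] ℝ).smulRight (EuclideanSpace.proj j : Rn n →L[ℝ] ℝ)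

variable {g : Rn n → Matrix (Fin n) (Fin n) ℝ} {U : Set (Rn n)} {x y : Rn n}

lemma metricForm_apply (v w : Rn n) : metricForm g x v w = ∑ i, ∑ j, g x i j * v i * w j := by
  simp [metricForm, mul_assoc]

lemma coordInner_eq (v w : Rn n) : coordInner g x v w = metricForm g x v w :=
  (metricForm_apply v w).symm

lemma metricForm_coordVec (i j : Fin n) : metricForm g x (coordVec i) (coordVec j) = g x i j := by
  rw [metricForm_apply]
  simp [coordVec]

lemma contDiffOn_metricForm (hg : ∀ i j, ContDiffOn ℝ ∞ (fun x => g x i j) U) :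
    ContDiffOn ℝ ∞ (metricForm g) U :=
  ContDiffOn.sum fun i _ => ContDiffOn.sum fun j _ => (hg i j).smul contDiffOn_const

/-! ### Christoffel symbols, curvature and Finsler quantities in components -/

section Metric

variable (hH : IsMetricOn U (metricForm g))
include hH

lemma pderiv_metric (hx : x ∈ U) (i j k : Fin n) : pderiv k (fun x => g x i j) x =
    fderiv ℝ (metricForm g) x (coordVec k) (coordVec i) (coordVec j) := by
  have h1 : (fun x => g x i j) = fun x => metricForm g x (coordVec i) (coordVec j) :=
    funext fun x => (metricForm_coordVec i j).symm
  have hd : DifferentiableAt ℝ (metricForm g) x :=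
    (hH.smooth.contDiffAt (hH.isOpen.mem_nhds hx)).differentiableAt (by simp)
  rw [pderiv, h1, fderiv_clm_apply (by fun_prop) (by fun_prop),
    fderiv_clm_apply hd (by fun_prop)]
  simp

lemma christoffel_eq (hx : x ∈ U) (i j k : Fin n) :
    christoffel g i j k x = gam (metricForm g) x (coordVec j) (coordVec k) i := by
  have hs (v : Rn n) (l : Fin n) : ∑ m, g x l m * v m = metricForm g x (coordVec l) v := by
    rw [← sum_apply_coordVec]
    simp [metricForm_coordVec, mul_comm]
  have hinj : ∀ v : Rn n, (∀ i, ∑ j, g x i j * v j = 0) → v = 0 := by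
    intro v hv
    refine hH.ext hx fun z => ?_
    rw [map_zero, zero_apply, hH.symm x hx, ← sum_apply_coordVec (metricForm g x) z, sum_apply]
    simp [← hs, hv]
  rw [christoffel, Finset.mul_sum]
  simp only [pderiv_metric hH hx]
  -- The vector `Γ(∂_j, ∂_k)` solves the system with matrix `g` whose right side is the Koszul
  -- expression.
  rw [← inv_mul_sum hinj (fun l => hs _ l) i]
  refine Finset.sum_congr rfl fun l _ => ?_
  rw [hH.symm x hx, hH.apply_gam hx, hH.fderiv_symm hx (coordVec j) (coordVec l),
    hH.fderiv_symm hx (coordVec k) (coordVec l)]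
  ring

lemma pderiv_christoffel (hx : x ∈ U) (i j k m : Fin n) : pderiv m (christoffel g i j k) x =
    fderiv ℝ (gam (metricForm g)) x (coordVec m) (coordVec j) (coordVec k) i := by
  have h1 : christoffel g i j k =ᶠ[nhds x] fun x =>
      (EuclideanSpace.proj i : Rn n →L[ℝ] ℝ) (gam (metricForm g) x (coordVec j) (coordVec k)) :=
    Filter.eventually_of_mem (hH.isOpen.mem_nhds hx) fun x hx => christoffel_eq hH hx i j k
  have hd : DifferentiableAt ℝ (gam (metricForm g)) x :=
    (hH.smooth_gam.contDiffAt (hH.isOpen.mem_nhds hx)).differentiableAt (by simp)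
  have h2 : DifferentiableAt ℝ (fun x => gam (metricForm g) x (coordVec j)) x := by fun_prop
  rw [pderiv, h1.fderiv_eq, fderiv_clm_apply (by fun_prop) (by fun_prop),
    fderiv_clm_apply h2 (by fun_prop), fderiv_clm_apply hd (by fun_prop)]
  simp

lemma curvatureTensor_eq (hx : x ∈ U) (i j k l : Fin n) : curvatureTensor g i j k l x =
    riem (metricForm g) x (coordVec k) (coordVec l) (coordVec j) i := by
  have hs (u v : Rn n) : ∑ m, gam (metricForm g) x u (coordVec m) i * v m =
      gam (metricForm g) x u v i := by
    rw [← sum_apply_coordVec (gam (metricForm g) x u) v]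
    simp [mul_comm]
  rw [curvatureTensor, pderiv_christoffel hH hx, pderiv_christoffel hH hx]
  simp only [christoffel_eq hH hx, Finset.sum_sub_distrib, hs, riem, PiLp.sub_apply,
    PiLp.add_apply]
  ring

/-- `riem` is a plain function, so its linearity in each of the three slots is read off its formula,
one slot at a time. -/
lemma riem_linear (A : Rn n →L[ℝ] ℝ) (u v z : Rn n) :
    ∑ j, ∑ k, ∑ l, A (riem (metricForm g) x (coordVec k) (coordVec l) (coordVec j))
      * z j * u k * v l = A (riem (metricForm g) x u v z) := by
  have h1 (u v : Rn n) : ∑ j, z j • riem (metricForm g) x u v (coordVec j) =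
      riem (metricForm g) x u v z := by
    conv_rhs => rw [← sum_coordVec z]
    simp only [riem, map_sum, map_smul, ← Finset.sum_sub_distrib, ← Finset.sum_add_distrib,
      smul_add, smul_sub]
  have h2 (v z : Rn n) : ∑ k, u k • riem (metricForm g) x (coordVec k) v z =
      riem (metricForm g) x u v z := by
    conv_rhs => rw [← sum_coordVec u]
    simp only [riem, map_sum, map_smul, ← Finset.sum_sub_distrib, ← Finset.sum_add_distrib,
      smul_add, smul_sub, sum_apply, smul_apply]
  have h3 (u z : Rn n) : ∑ l, v l • riem (metricForm g) x u (coordVec l) z =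
      riem (metricForm g) x u v z := by
    conv_rhs => rw [← sum_coordVec v]
    simp only [riem, map_sum, map_smul, ← Finset.sum_sub_distrib, ← Finset.sum_add_distrib,
      smul_add, smul_sub, sum_apply, smul_apply]
  rw [← h1, map_sum]
  refine Finset.sum_congr rfl fun j _ => ?_
  rw [← h2, map_smul, map_sum, smul_eq_mul, Finset.mul_sum]
  refine Finset.sum_congr rfl fun k _ => ?_
  rw [← h3, map_smul, map_sum, smul_eq_mul, Finset.mul_sum, Finset.mul_sum]
  refine Finset.sum_congr rfl fun l _ => ?_
  rw [map_smul, smul_eq_mul]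
  ring

lemma sectionalCurvature_eq (hx : x ∈ U) (v w : Rn n) : sectionalCurvature g x v w =
    metricForm g x (riem (metricForm g) x v w w) v / (metricForm g x v v * metricForm g x w w -
      metricForm g x v w ^ 2) := by
  rw [sectionalCurvature]
  simp only [coordInner_eq]
  congr 1
  rw [hH.symm x hx, metricForm_apply]
  refine Finset.sum_congr rfl fun i _ => ?_
  -- The covector that lowers the upper curvature index to the fixed index `i`.
  set A : Rn n →L[ℝ] ℝ := ∑ p, g x i p • (EuclideanSpace.proj p : Rn n →L[ℝ] ℝ) with hA
  have hA' (u : Rn n) : ∑ p, g x i p * u p = A u := by simp [hA]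
  have h2 : ∑ p, g x i p * v i * riem (metricForm g) x v w w p =
      v i * A (riem (metricForm g) x v w w) := by
    rw [← hA', Finset.mul_sum]
    exact Finset.sum_congr rfl fun p _ => by ring
  simp only [curvatureTensor_eq hH hx, hA']
  rw [h2, ← riem_linear hH A v w w]
  simp only [Finset.mul_sum]
  exact Finset.sum_congr rfl fun j _ => Finset.sum_congr rfl fun k _ =>
    Finset.sum_congr rfl fun l _ => by ring

variable {W : Rn n → Rn n} (hW : IsUnitFieldOn U (metricForm g) W)
include hW

/-- The second index is the direction of differentiation; the Christoffel term of `fderiv_wind`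
cancels the one in `covDeriv`. -/
lemma covDeriv_eq {w : Fin n → Rn n → ℝ}
    (hw : ∀ x ∈ U, ∀ i, w i x = metricForm g x (W x) (coordVec i)) (hx : x ∈ U) (i j : Fin n) :
    covDeriv g w i j x = metricForm g x (cov (metricForm g) W x (coordVec j)) (coordVec i) := by
  have h1 : w i =ᶠ[nhds x] fun x => metricForm g x (W x) (coordVec i) :=
    Filter.eventually_of_mem (hH.isOpen.mem_nhds hx) fun x hx => hw x hx i
  have hd : DifferentiableAt ℝ (metricForm g) x :=
    (hH.smooth.contDiffAt (hH.isOpen.mem_nhds hx)).differentiableAt (by simp)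
  have hd' : DifferentiableAt ℝ W x :=
    (hW.smooth.contDiffAt (hH.isOpen.mem_nhds hx)).differentiableAt (by simp)
  have h2 : pderiv j (w i) x = fderiv ℝ (metricForm g) x (coordVec j) (W x) (coordVec i)
      + metricForm g x (fderiv ℝ W x (coordVec j)) (coordVec i) := by
    rw [pderiv, h1.fderiv_eq, fderiv_clm_apply (by fun_prop) (by fun_prop),
      fderiv_clm_apply hd hd']
    simp [add_comm]
  have h3 : ∑ k, christoffel g k i j x * w k x =
      metricForm g x (W x) (gam (metricForm g) x (coordVec i) (coordVec j)) := by
    rw [← sum_apply_coordVec]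
    exact Finset.sum_congr rfl fun k _ => by rw [christoffel_eq hH hx, hw x hx]; rfl
  rw [covDeriv, h2, h3, fderiv_wind hH hW hx, hH.gam_symm hx (coordVec i)]
  ring

lemma kro1_sum (v : Rn n) : kro1 (metricForm g) W x y v =
    ∑ j, v j * kro1 (metricForm g) W x y (coordVec j) := by
  have := sum_apply_coordVec ((metricForm g x (W x) y)⁻¹ •
    (metricForm g x y - kro (metricForm g) W x y • metricForm g x (W x))) v
  simp only [smul_apply, sub_apply, smul_eq_mul] at this
  simp only [kro1, div_eq_inv_mul]
  exact this.symm

lemma kro2_sum (η v : Rn n) : kro2 (metricForm g) W x y η v =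
    ∑ j, v j * kro2 (metricForm g) W x y η (coordVec j) := by
  have hs (A : Rn n →L[ℝ] ℝ) : A v = ∑ j, v j * A (coordVec j) := (sum_apply_coordVec A v).symm
  simp only [kro2, kro1_sum hH hW v, hs (metricForm g x η), hs (metricForm g x (W x)),
    Finset.mul_sum, Finset.sum_mul, ← Finset.sum_sub_distrib, Finset.sum_div]
  exact Finset.sum_congr rfl fun j _ => by ring

variable {L : Rn n → Rn n → ℝ}
  (hL : ∀ x y, (x, y) ∈ cone U (metricForm g) W → L x y = kro (metricForm g) W x y ^ 2)
include hL

lemma partialY_partialY_eq (h : (x, y) ∈ cone U (metricForm g) W) (i j : Fin n) :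
    fundamentalTensor L x y i j =
      kro1 (metricForm g) W x y (coordVec i) * kro1 (metricForm g) W x y (coordVec j)
        + kro (metricForm g) W x y * kro2 (metricForm g) W x y (coordVec i) (coordVec j) := by
  have h1 : fundamentalTensor L x y i j =
    (1 / 2 : ℝ) * dY (coordVec i) (dY (coordVec j) L) x y := rfl
  rw [h1, dY_congr (isOpen_cone hH hW)
    (fun x y h => dY_congr (isOpen_cone hH hW) hL h (coordVec j)) h, dY_dY_kro_sq hH hW h]
  ring

lemma sum_fundamentalTensor (h : (x, y) ∈ cone U (metricForm g) W) (i : Fin n) (v : Rn n) :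
    ∑ j, fundamentalTensor L x y i j * v j =
      kro1 (metricForm g) W x y (coordVec i) * kro1 (metricForm g) W x y v
        + kro (metricForm g) W x y * kro2 (metricForm g) W x y (coordVec i) v := by
  rw [kro1_sum hH hW v, kro2_sum hH hW _ v, Finset.mul_sum, Finset.mul_sum, ← Finset.sum_add_distrib]
  refine Finset.sum_congr rfl fun j _ => ?_
  rw [partialY_partialY_eq hH hW hL h]
  ring

lemma geodesicCoeff_eq (h : (x, y) ∈ cone U (metricForm g) W) (i : Fin n) :
    geodesicCoeff L i x y = (kroSprayReg (metricForm g) W x y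
      + kroSprayProj (metricForm g) W x y • y) i := by
  have hΩ := isOpen_cone hH hW
  have hsym (u v : Rn n) : kro2 (metricForm g) W x y u v = kro2 (metricForm g) W x y v u := by
    rw [kro2, kro2, hH.symm x h.1 u v]; ring
  -- Contracting `g v = 0` with `v` puts `v` in the null set of the definite form of
  -- `eq_zero_of_kro_form`; hence `inv_mul_sum` applies with the solution from `kro_spray_eq`.
  have hinj : ∀ v : Rn n, (∀ i, ∑ j, fundamentalTensor L x y i j * v j = 0) → v = 0 := by
    intro v hv
    simp only [sum_fundamentalTensor hH hW hL h] at hv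
    refine eq_zero_of_kro_form hH hW h ?_
    have h1 : ∑ j, v j * (kro1 (metricForm g) W x y (coordVec j) * kro1 (metricForm g) W x y v
        + kro (metricForm g) W x y * kro2 (metricForm g) W x y (coordVec j) v) = 0 := by
      simp [hv]
    rw [← h1, kro2_sum hH hW v v]
    nth_rewrite 1 [kro1_sum hH hW v]
    rw [Finset.sum_mul, Finset.mul_sum, ← Finset.sum_add_distrib]
    exact Finset.sum_congr rfl fun j _ => by rw [hsym v]; ring
  rw [geodesicCoeff, Finset.mul_sum]
  rw [← inv_mul_sum hinj (fun l => sum_fundamentalTensor hH hW hL h l _) i]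
  refine Finset.sum_congr rfl fun l _ => ?_
  have h2 : ∑ k, partialX k (partialY l L) x y * y k = dX y (dY (coordVec l) L) x y := by
    conv_rhs => rw [← sum_coordVec y]
    rw [dX_sum_dir, sum_coordVec]
    exact Finset.sum_congr rfl fun k _ => by rw [dX_smul_dir, smul_eq_mul, mul_comm]; rfl
  have h3 : partialX l L x y = dX (coordVec l) L x y := rfl
  rw [h2, h3, dX_congr hΩ (fun x y h => dY_congr hΩ hL h (coordVec l)) h, dX_congr hΩ hL h,
    hsym, mul_comm (kro1 _ _ _ _ (coordVec l)), kro_spray_eq hH hW h]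
  ring

lemma riemannCurvature_eq (h : (x, y) ∈ cone U (metricForm g) W) (i k : Fin n) :
    riemannCurvature L i k x y = sprayCurvature (fun x y => kroSprayReg (metricForm g) W x y
      + kroSprayProj (metricForm g) W x y • y) (coordVec k) x y i := by
  set G : Rn n → Rn n → Rn n := fun x y => kroSprayReg (metricForm g) W x y
      + kroSprayProj (metricForm g) W x y • y with hG
  have hΩ := isOpen_cone hH hW
  have hGs : SmoothPair (cone U (metricForm g) W) G :=
    ContDiffOn.add (windRationalVec_kroSprayReg hH hW).smooth
      (ContDiffOn.smul (smooth_kroSprayProj hH hW) contDiffOn_snd)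
  have cX {D : Rn n → Rn n → Rn n} (hD : SmoothPair (cone U (metricForm g) W) D)
      {f : Rn n → Rn n → ℝ} {i : Fin n}
      (hf : ∀ x y, (x, y) ∈ cone U (metricForm g) W → f x y = D x y i)
      (v : Rn n) {x y : Rn n} (h : (x, y) ∈ cone U (metricForm g) W) :
      dX v f x y = dX v D x y i := by
    rw [dX_congr hΩ hf h]
    exact congrArg (fun A => A v) (((EuclideanSpace.proj i : Rn n →L[ℝ] ℝ).hasFDerivAt).comp x
      (hD.differentiableAt_left hΩ h).hasFDerivAt).fderiv
  have cY {D : Rn n → Rn n → Rn n} (hD : SmoothPair (cone U (metricForm g) W) D)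
      {f : Rn n → Rn n → ℝ} {i : Fin n}
      (hf : ∀ x y, (x, y) ∈ cone U (metricForm g) W → f x y = D x y i)
      (v : Rn n) {x y : Rn n} (h : (x, y) ∈ cone U (metricForm g) W) :
      dY v f x y = dY v D x y i := by
    rw [dY_congr hΩ hf h]
    exact congrArg (fun A => A v) (((EuclideanSpace.proj i : Rn n →L[ℝ] ℝ).hasFDerivAt).comp y
      (hD.differentiableAt_right hΩ h).hasFDerivAt).fderiv
  have hg (i : Fin n) (x y : Rn n) (h : (x, y) ∈ cone U (metricForm g) W) :
      geodesicCoeff L i x y = G x y i := geodesicCoeff_eq hH hW hL h i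
  have hgk := hGs.dY hΩ (coordVec k)
  have e1 : partialX k (geodesicCoeff L i) x y = dX (coordVec k) G x y i := cX hGs (hg i) _ h
  have e2 (k i : Fin n) {x y : Rn n} (h : (x, y) ∈ cone U (metricForm g) W) :
      partialY k (geodesicCoeff L i) x y = dY (coordVec k) G x y i := cY hGs (hg i) _ h
  have e3 (m : Fin n) : partialX m (partialY k (geodesicCoeff L i)) x y =
      dX (coordVec m) (dY (coordVec k) G) x y i := cX hgk (fun x y h => e2 k i h) _ h
  have e4 (m : Fin n) : partialY m (partialY k (geodesicCoeff L i)) x y =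
      dY (coordVec m) (dY (coordVec k) G) x y i := cY hgk (fun x y h => e2 k i h) _ h
  have sX (D : Rn n → Rn n → Rn n) (v : Rn n) :
      ∑ m, v m * dX (coordVec m) D x y i = dX v D x y i := by
    conv_rhs => rw [← sum_coordVec v, dX_sum_dir]
    simp [dX_smul_dir]
  have sY (D : Rn n → Rn n → Rn n) (v : Rn n) :
      ∑ m, v m * dY (coordVec m) D x y i = dY v D x y i := by
    conv_rhs => rw [← sum_coordVec v, dY_sum_dir]
    simp [dY_smul_dir]
  rw [riemannCurvature]
  simp only [e1, e2 _ _ h, e3, e4, hg _ x y h, sX, sY, mul_comm (dY _ G x y i)]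
  simp [sprayCurvature]

/-- The condition of constant flag curvature in terms of the curvature of the spray. -/
lemma riemannCurvature_eq_iff {K : ℝ} (h : (x, y) ∈ cone U (metricForm g) W) :
    (∀ i k, riemannCurvature L i k x y = K * (L x y * (if i = k then 1 else 0)
      - (∑ j, fundamentalTensor L x y k j * y j) * y i)) ↔
    ∀ η, sprayCurvature (fun x y => kroSprayReg (metricForm g) W x y
      + kroSprayProj (metricForm g) W x y • y) η x y =
      K • (kro (metricForm g) W x y ^ 2 • η
        - (kro (metricForm g) W x y * kro1 (metricForm g) W x y η) • y) := by
  have hw : metricForm g x (W x) y ≠ 0 := h.2.ne'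
  have hq := sq_eq_kro hH hW h
  -- Euler's relations `dF(y) = F` and `d²F(η,y) = 0`; together they give `g_{kj} y^j = F dF(∂_k)`.
  have g1 : kro1 (metricForm g) W x y y = kro (metricForm g) W x y := by
    rw [kro1, hq]; field_simp; ring
  have g2 (η : Rn n) : kro2 (metricForm g) W x y η y = 0 := by
    rw [kro2, g1, kro1, hH.symm x h.1 η]; field_simp; ring
  simp only [riemannCurvature_eq hH hW hL h, hL x y h, sum_fundamentalTensor hH hW hL h, g1, g2,
    mul_zero, add_zero]
  set G : Rn n → Rn n → Rn n := fun x y => kroSprayReg (metricForm g) W x y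
      + kroSprayProj (metricForm g) W x y • y with hG
  have hΩ := isOpen_cone hH hW
  have hGs : SmoothPair (cone U (metricForm g) W) G :=
    ContDiffOn.add (windRationalVec_kroSprayReg hH hW).smooth
      (ContDiffOn.smul (smooth_kroSprayProj hH hW) contDiffOn_snd)
  constructor
  · intro hR η
    -- In two terms `η` sits in the inner derivative; symmetry of second derivatives moves it
    -- outside, where linearity in the direction is immediate.
    have hlin : sprayCurvature G η x y = ∑ k, η k • sprayCurvature G (coordVec k) x y := by
      have hYη (x y : Rn n) (_ : (x, y) ∈ cone U (metricForm g) W) :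
          dY η G x y = ∑ k, η k • dY (coordVec k) G x y := by
        conv_lhs => rw [← sum_coordVec η, dY_sum_dir]
        simp only [dY_smul_dir]
      have s1 : dX y (dY η G) x y = ∑ k, η k • dX y (dY (coordVec k) G) x y := by
        conv_lhs => rw [← sum_coordVec η]
        simp only [dX_dY_comm hΩ hGs h, dY_sum_dir, dY_smul_dir]
      have s2 : dY (G x y) (dY η G) x y = ∑ k, η k • dY (G x y) (dY (coordVec k) G) x y := by
        conv_lhs => rw [← sum_coordVec η]
        simp only [dY_dY_comm hΩ hGs h (G x y), dY_sum_dir, dY_smul_dir]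
      have s3 : dX η G x y = ∑ k, η k • dX (coordVec k) G x y := by
        conv_lhs => rw [← sum_coordVec η, dX_sum_dir]
        simp only [dX_smul_dir]
      simp only [sprayCurvature]
      rw [s1, s2, s3, hYη x y h, dY_sum_dir, Finset.smul_sum, Finset.smul_sum,
        ← Finset.sum_sub_distrib, ← Finset.sum_add_distrib, ← Finset.sum_sub_distrib]
      refine Finset.sum_congr rfl fun k _ => ?_
      rw [dY_smul_dir]
      module
    have hk (k : Fin n) : sprayCurvature G (coordVec k) x y =
        K • (kro (metricForm g) W x y ^ 2 • coordVec k
        - (kro (metricForm g) W x y * kro1 (metricForm g) W x y (coordVec k)) • y) := by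
      ext i
      rw [hR i k]
      simp only [coordVec, PiLp.smul_apply, PiLp.sub_apply, smul_eq_mul,
        PiLp.single_apply]
      ring
    rw [hlin, kro1_sum hH hW η]
    have hη : kro (metricForm g) W x y ^ 2 • η =
        ∑ k, (kro (metricForm g) W x y ^ 2 * η k) • coordVec k := by
      conv_lhs => rw [← sum_coordVec η, Finset.smul_sum]
      simp only [smul_smul]
    rw [hη]
    simp only [hk, Finset.mul_sum, Finset.sum_smul, ← Finset.sum_sub_distrib]
    rw [Finset.smul_sum]
    exact Finset.sum_congr rfl fun k _ => by module
  · intro hR i k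
    rw [hR]
    simp only [coordVec, PiLp.smul_apply, PiLp.sub_apply, smul_eq_mul,
      PiLp.single_apply]
    ring

end Metric

end Index

/-! ### Constant flag curvature and constant sectional curvature -/

section LocalEquivalence

variable {E : Type*} [NormedAddCommGroup E] [NormedSpace ℝ E] [FiniteDimensional ℝ E]
variable {U : Set E} {H : E → E →L[ℝ] E →L[ℝ] ℝ} {W : E → E} {x y : E} {K : ℝ}

section Metric

variable (hH : IsMetricOn U H)
include hH

/-- Strict Cauchy–Schwarz: the squared length of `⟨w,w⟩ v - ⟨v,w⟩ w ≠ 0` is `⟨w,w⟩` times the Gram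
determinant. -/
lemma gram_pos (hx : x ∈ U) {v w : E} (hvw : LinearIndependent ℝ ![v, w]) :
    0 < H x v v * H x w w - H x v w ^ 2 := by
  have hw0 : w ≠ 0 := by simpa using hvw.ne_zero 1
  have hw := hH.pos x hx w hw0
  have hz : H x w w • v - H x v w • w ≠ 0 := fun h => by
    have := LinearIndependent.pair_iff.1 hvw (H x w w) (-H x v w) (by rw [neg_smul, ← h]; abel)
    exact hw.ne' this.1
  have h1 := hH.pos x hx _ hz
  simp only [map_sub, map_smul, sub_apply, smul_apply, smul_eq_mul, hH.symm x hx w v] at h1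
  have h2 : 0 < H x w w * (H x v v * H x w w - H x v w ^ 2) := by nlinarith
  exact (pos_iff_pos_of_mul_pos h2).1 hw

lemma riem_smul_left (c : ℝ) (u v z : E) : riem H x (c • u) v z = c • riem H x u v z := by
  simp only [riem, map_smul, smul_apply]; module

lemma riem_add_left (u v w z : E) : riem H x (u + v) w z = riem H x u w z + riem H x v w z := by
  simp only [riem, map_add, add_apply]; abel

lemma riem_self (u z : E) : riem H x u u z = 0 := by simp [riem]

/-- Sectional curvatures determine the Jacobi operators. -/
lemma riem_eq_of_sectional (hx : x ∈ U) (h : ∀ v w, LinearIndependent ℝ ![v, w] →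
    H x (riem H x v w w) v / (H x v v * H x w w - H x v w ^ 2) = K) (v w : E) :
    riem H x v w w = K • (H x w w • v - H x v w • w) := by
  -- Clearing the denominator also covers dependent pairs, where both sides vanish.
  have h1 (v w : E) : H x (riem H x v w w) v = K * (H x v v * H x w w - H x v w ^ 2) := by
    by_cases hvw : LinearIndependent ℝ ![v, w]
    · rw [← h v w hvw]
      have := (gram_pos hH hx hvw).ne'
      field_simp
    · rw [LinearIndependent.pair_iff] at hvw
      push Not at hvw
      obtain ⟨s, t, hst, h0⟩ := hvw
      by_cases hs : s = 0
      · have ht := h0 hs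
        have hw : w = 0 := by simpa [hs, ht] using hst
        simp [hw, riem]
      · have hv : v = (-(s⁻¹ * t)) • w := by
          have : s • v = (-t) • w := by rw [neg_smul]; exact eq_neg_of_add_eq_zero_left hst
          rw [← mul_neg, mul_smul, ← this, smul_smul, inv_mul_cancel₀ hs, one_smul]
        rw [hv, riem_smul_left hH, riem_self hH]
        simp only [smul_zero, map_zero, zero_apply, map_smul, smul_apply, smul_eq_mul]
        ring
  -- The Jacobi operator `v ↦ R(v,w)w` is self-adjoint, so polarising its quadratic form in `v`
  -- determines it.
  have hsymm (v v' w : E) : H x (riem H x v w w) v' = H x (riem H x v' w w) v := by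
    rw [hH.riem_pair_symm hx, riem_antisymm, map_neg, neg_apply, hH.riem_skew_adjoint hx, neg_neg,
      hH.symm x hx]
  refine hH.ext hx fun v' => ?_
  have h2 := h1 (v + v') w
  have h3 := h1 v w
  have h4 := h1 v' w
  have h5 := hsymm v v' w
  have h6 := hH.symm x hx v v'
  simp only [riem_add_left hH, map_add, add_apply] at h2
  simp only [map_sub, map_smul, sub_apply, smul_apply, smul_eq_mul, hH.symm x hx w v']
  linear_combination (1 / 2) * (h2 - h3 - h4 + h5) - (1 / 2) * K * H x w w * h6

end Metric

variable (hH : IsMetricOn U H) (hW : IsUnitFieldOn U H W)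
include hH hW

/-- The navigation equation multiplied by `F`. -/
lemma sq_sub_kro (h : (x, y) ∈ cone U H W) :
    H x (y - kro H W x y • W x) (y - kro H W x y • W x) = kro H W x y ^ 2 := by
  simp only [map_sub, map_smul, sub_apply, smul_apply, smul_eq_mul, hH.symm x h.1 y (W x),
    hW.unit x h.1, sq_eq_kro hH hW h]
  ring

/-- Half the derivative along `η` of `|y - F W|² = F²`. -/
lemma apply_sub_kro (h : (x, y) ∈ cone U H W) (η : E) :
    H x (η - kro1 H W x y η • W x) (y - kro H W x y • W x) = kro H W x y * kro1 H W x y η := by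
  have hw : H x (W x) y ≠ 0 := h.2.ne'
  have e : H x y η = kro1 H W x y η * H x (W x) y + kro H W x y * H x (W x) η := by
    rw [kro1]; field_simp; ring
  simp only [map_sub, map_smul, sub_apply, smul_apply, smul_eq_mul, hH.symm x h.1 η, e,
    hW.unit x h.1]
  ring

section Killing

variable (hK : ∀ x ∈ U, ∀ u v, H x (cov H W x u) v = - H x u (cov H W x v))
include hK

lemma sprayCurvature_kroSpray (h : (x, y) ∈ cone U H W) (η : E) :
    sprayCurvature (fun x y => kroSprayReg H W x y + kroSprayProj H W x y • y) η x y =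
      riem H x (η - kro1 H W x y η • W x) (y - kro H W x y • W x) (y - kro H W x y • W x) := by
  rw [sprayCurvature_congr (isOpen_cone hH hW)
    (fun x y h => kroSpray_of_killing hH hW hK h.1) h, sprayCurvature_killingSpray hH hW hK h]

lemma sprayCurvature_of_riem (h : (x, y) ∈ cone U H W)
    (hR : ∀ v w, riem H x v w w = K • (H x w w • v - H x v w • w)) (η : E) :
    sprayCurvature (fun x y => kroSprayReg H W x y + kroSprayProj H W x y • y) η x y =
      K • (kro H W x y ^ 2 • η - (kro H W x y * kro1 H W x y η) • y) := by
  rw [sprayCurvature_kroSpray hH hW hK h, hR, sq_sub_kro hH hW h, apply_sub_kro hH hW h]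
  module

/-- Inverts the substitution in the curvature formula: given `v` and `w`, one looks for `y` and `η`
with `y - F W = w` and `η - dF(η) W = v`. -/
lemma riem_of_sprayCurvature (hx : x ∈ U)
    (hC : ∀ y, (x, y) ∈ cone U H W → ∀ η : E,
      sprayCurvature (fun x y => kroSprayReg H W x y + kroSprayProj H W x y • y) η x y =
        K • (kro H W x y ^ 2 • η - (kro H W x y * kro1 H W x y η) • y)) (v w : E) :
    riem H x v w w = K • (H x w w • v - H x v w • w) := by
  have main (w : E) (hw : 0 < √(H x w w) + H x (W x) w) (hw0 : w ≠ 0) :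
      riem H x v w w = K • (H x w w • v - H x v w • w) := by
    set s := √(H x w w) with hs
    have hp := hH.pos x hx w hw0
    have hs0 : 0 < s := Real.sqrt_pos.2 hp
    have hs2 : H x w w = s ^ 2 := (Real.sq_sqrt hp.le).symm
    -- Since `|y - F W| = F`, the equation `y - F W = w` forces `F = |w|`. This `y` lies in the cone
    -- unless `w` is a nonpositive multiple of `W`.
    set y := w + s • W x with hy
    have hwy : H x (W x) y = s + H x (W x) w := by
      simp [hy, hW.unit x hx, add_comm]
    have hm : (x, y) ∈ cone U H W := ⟨hx, by rw [hwy]; exact hw⟩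
    have hwy0 : s + H x (W x) w ≠ 0 := hw.ne'
    have hF : kro H W x y = s := by
      rw [kro, hwy, hy]
      simp only [map_add, map_smul, add_apply, smul_apply, smul_eq_mul, hs2, hW.unit x hx,
        hH.symm x hx w (W x)]
      field_simp
      ring
    have hξ : y - kro H W x y • W x = w := by rw [hF, hy]; abel
    -- The value that `dF(η)` must have, from `⟨η - dF(η) W, w⟩ = F dF(η)`.
    set c := H x v w / s with hc
    have h1 : kro1 H W x y (v + c • W x) = c := by
      rw [kro1, hwy, hF, hy]
      simp only [map_add, map_smul, add_apply, smul_apply, smul_eq_mul, hW.unit x hx,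
        hH.symm x hx w (W x), hH.symm x hx w v, hc]
      field_simp
      ring
    have h2 := hC y hm (v + c • W x)
    have h3 : v + c • W x - c • W x = v := by abel
    rw [sprayCurvature_kroSpray hH hW hK hm, h1, hξ, hF, h3] at h2
    have h4 : s * c = H x v w := by rw [hc]; field_simp
    rw [h2, hs2, h4, hy, ← h4]
    module
  by_cases hw0 : w = 0
  · simp [hw0, riem]
  by_cases hw : 0 < √(H x w w) + H x (W x) w
  · exact main w hw hw0
  · have hp : 0 < √(H x w w) := Real.sqrt_pos.2 (hH.pos x hx w hw0)
    -- The asserted identity is even in `w`, and `-w` satisfies the strict inequality here.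
    have h1 := main (-w) (by simp only [map_neg, neg_apply, neg_neg]; linarith)
      (neg_ne_zero.2 hw0)
    have h2 : riem H x v (-w) (-w) = riem H x v w w := by simp [riem]
    rw [h2] at h1
    rw [h1]
    simp only [map_neg, neg_apply, neg_neg]
    module

/-- For `v ≠ 0` orthogonal to `W`, available in dimension at least two, skewness and `cov_cov` give
`|∇_v W|² = ⟨R(v,W)W,v⟩ = K |v|²`. -/
lemma curvature_nonneg (hx : x ∈ U) (hn : 2 ≤ Module.finrank ℝ E)
    (hR : ∀ v w, riem H x v w w = K • (H x w w • v - H x v w • w)) : 0 ≤ K := by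
  obtain ⟨v, hv, hv0⟩ : ∃ v ∈ LinearMap.ker (H x (W x) : E →ₗ[ℝ] ℝ), v ≠ 0 :=
    Submodule.exists_mem_ne_zero_of_ne_bot
      (LinearMap.ker_ne_bot_of_finrank_lt (by rw [Module.finrank_self]; omega))
  have hv' : H x v (W x) = 0 := by rw [hH.symm x hx]; exact hv
  have hp := hH.pos x hx v hv0
  have h1 : 0 ≤ H x (cov H W x v) (cov H W x v) := by
    by_cases h0 : cov H W x v = 0
    · simp [h0]
    · exact (hH.pos x hx _ h0).le
  rw [hK x hx, hW.cov_cov hH hK hx, riem_antisymm, hR, hW.unit x hx, hv'] at h1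
  simp only [one_smul, zero_smul, sub_zero, map_neg, neg_neg, map_smul, smul_eq_mul] at h1
  exact nonneg_of_mul_nonneg_left h1 hp

end Killing

end LocalEquivalence

/-! ### Coordinate expressions on a manifold -/

section Charts

variable {n : ℕ} {M : Type*} [TopologicalSpace M] [ChartedSpace (EuclideanSpace ℝ (Fin n)) M]
  [IsManifold (𝓡 n) ∞ M]
variable {e : OpenPartialHomeomorph M (Rn n)} {x : Rn n}

lemma frame_bijective (he : e ∈ IsManifold.maximalAtlas (𝓡 n) ∞ M) (hx : x ∈ e.target) :
    Function.Bijective (frame e x) := by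
  have h : e.MDifferentiable (𝓡 n) (𝓡 n) :=
    ⟨(contMDiffOn_of_mem_maximalAtlas he).mdifferentiableOn (by simp),
      (contMDiffOn_symm_of_mem_maximalAtlas he).mdifferentiableOn (by simp)⟩
  exact h.symm.mfderiv_bijective (x := x) hx

/-- The tangent map of `e.symm` applied to a constant section. -/
lemma contMDiffOn_frame (he : e ∈ IsManifold.maximalAtlas (𝓡 n) ∞ M) (v : Rn n) :
    ContMDiffOn (𝓡 n) ((𝓡 n).prod 𝓘(ℝ, Rn n)) ∞
      (fun u => Bundle.TotalSpace.mk' (Rn n) (E := fun x : M => TangentSpace (𝓡 n) x)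
        (e.symm u) (frame e u v)) e.target := by
  have h1 := (contMDiffOn_symm_of_mem_maximalAtlas he).contMDiffOn_tangentMapWithin (m := ∞)
    (by simp) e.open_target.uniqueMDiffOn
  have h2 : ContMDiffOn (𝓡 n) (𝓡 n).tangent ∞
      (fun u => (⟨u, v⟩ : TangentBundle (𝓡 n) (Rn n))) e.target :=
    contMDiffOn_vectorSpace_iff_contDiffOn.2 contDiffOn_const
  have h3 := h1.comp h2 fun u hu => hu
  refine h3.congr fun u hu => ?_
  simp only [Function.comp, tangentMapWithin, frame,
    mfderivWithin_of_isOpen e.open_target hu]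
  rfl

lemma contDiffOn_inner (h : RiemMetric n M)
    {V V' : (u : Rn n) → TangentSpace (𝓡 n) (e.symm u)}
    (he : e ∈ IsManifold.maximalAtlas (𝓡 n) ∞ M)
    (hV : ContMDiffOn (𝓡 n) ((𝓡 n).prod 𝓘(ℝ, Rn n)) ∞
      (fun u => Bundle.TotalSpace.mk' (Rn n) (E := fun x : M => TangentSpace (𝓡 n) x)
        (e.symm u) (V u)) e.target)
    (hV' : ContMDiffOn (𝓡 n) ((𝓡 n).prod 𝓘(ℝ, Rn n)) ∞
      (fun u => Bundle.TotalSpace.mk' (Rn n) (E := fun x : M => TangentSpace (𝓡 n) x)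
        (e.symm u) (V' u)) e.target) :
    ContDiffOn ℝ ∞ (fun u => h.inner (e.symm u) (V u) (V' u)) e.target := by
  have h1 := h.contMDiff.comp_contMDiffOn (contMDiffOn_symm_of_mem_maximalAtlas he)
  have h2 : ContMDiffOn (𝓡 n) ((𝓡 n).prod 𝓘(ℝ, ℝ)) ∞
      (fun u => Bundle.TotalSpace.mk' ℝ (E := Bundle.Trivial M ℝ) (e.symm u)
        (h.inner (e.symm u) (V u) (V' u))) e.target :=
    ContMDiffOn.clm_bundle_apply₂ (F₁ := Rn n) (F₂ := Rn n) (F₃ := ℝ)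
      (E₁ := fun x : M => TangentSpace (𝓡 n) x) (E₂ := fun x : M => TangentSpace (𝓡 n) x)
      (E₃ := Bundle.Trivial M ℝ) (b := fun u => e.symm u)
      (ψ := fun u => h.inner (e.symm u)) h1 hV hV'
  exact fun u hu => ((Bundle.contMDiffWithinAt_totalSpace.1 (h2 u hu)).2).contDiffWithinAt

lemma metricForm_metricCoeff (h : RiemMetric n M) (e : OpenPartialHomeomorph M (Rn n))
    (x v w : Rn n) : metricForm (metricCoeff h e) x v w =
      h.inner (e.symm x) (frame e x v) (frame e x w) := by
  let f : Rn n →L[ℝ] Rn n := frame e x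
  let B : Rn n →L[ℝ] Rn n →L[ℝ] ℝ := h.inner (e.symm x)
  let A : Rn n →L[ℝ] Rn n →L[ℝ] ℝ := B.bilinearComp f f
  have h1 (v w : Rn n) : A v w = h.inner (e.symm x) (frame e x v) (frame e x w) := rfl
  rw [← h1, ← sum_apply_coordVec (metricForm (metricCoeff h e) x) v, ← sum_apply_coordVec A v,
    sum_apply, sum_apply]
  refine Finset.sum_congr rfl fun i _ => ?_
  rw [smul_apply, smul_apply, ← sum_apply_coordVec (metricForm (metricCoeff h e) x _) w,
    ← sum_apply_coordVec (A _) w]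
  congr 1
  refine Finset.sum_congr rfl fun j _ => ?_
  rw [metricForm_coordVec, h1]
  rfl

lemma isMetricOn_metricCoeff (h : RiemMetric n M)
    (he : e ∈ IsManifold.maximalAtlas (𝓡 n) ∞ M) :
    IsMetricOn e.target (metricForm (metricCoeff h e)) where
  isOpen := e.open_target
  smooth := contDiffOn_metricForm fun i j =>
    contDiffOn_inner h he (contMDiffOn_frame he _) (contMDiffOn_frame he _)
  symm x _ u v := by
    rw [metricForm_metricCoeff, metricForm_metricCoeff]; exact h.symm _ _ _
  pos x hx v hv := by
    rw [metricForm_metricCoeff]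
    refine h.pos _ _ fun h0 => hv ((frame_bijective he hx).1 ?_)
    rw [h0, map_zero]

/-- The components `W^i` of a vector field in the chart `e`. -/
def windCoord (h : RiemMetric n M) (W : SmoothVectorField n M)
    (e : OpenPartialHomeomorph M (Rn n)) (x : Rn n) : Rn n :=
  sharp (metricForm (metricCoeff h e)) x
    (∑ i, lowerCoeff h W e i x • (EuclideanSpace.proj i : Rn n →L[ℝ] ℝ))

lemma metricForm_windCoord (h : RiemMetric n M) (W : SmoothVectorField n M)
    (he : e ∈ IsManifold.maximalAtlas (𝓡 n) ∞ M) (hx : x ∈ e.target) (v : Rn n) :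
    metricForm (metricCoeff h e) x (windCoord h W e x) v =
      h.inner (e.symm x) (W (e.symm x)) (frame e x v) := by
  let A : Rn n →L[ℝ] ℝ := (h.inner (e.symm x) (W (e.symm x))).comp (frame e x)
  have h1 (v : Rn n) : h.inner (e.symm x) (W (e.symm x)) (frame e x v) = A v := rfl
  rw [windCoord, (isMetricOn_metricCoeff h he).apply_sharp hx, h1, ← sum_apply_coordVec A v,
    sum_apply]
  refine Finset.sum_congr rfl fun i _ => ?_
  rw [smul_apply]
  exact mul_comm _ _

lemma frame_windCoord (h : RiemMetric n M) (W : SmoothVectorField n M)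
    (he : e ∈ IsManifold.maximalAtlas (𝓡 n) ∞ M) (hx : x ∈ e.target) :
    frame e x (windCoord h W e x) = W (e.symm x) := by
  obtain ⟨v, hv⟩ := (frame_bijective he hx).2 (W (e.symm x))
  rw [← hv]
  congr 1
  refine (isMetricOn_metricCoeff h he).ext hx fun z => ?_
  rw [metricForm_windCoord h W he hx, metricForm_metricCoeff, hv]

/-- The covariant components are inner products of smooth sections and raising the index is smooth,
so the frame never has to be inverted smoothly. -/
lemma isUnitFieldOn_windCoord (h : RiemMetric n M) (W : SmoothVectorField n M)
    (hW : ∀ p, RiemMetric.length h p (W p) = 1)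
    (he : e ∈ IsManifold.maximalAtlas (𝓡 n) ∞ M) :
    IsUnitFieldOn e.target (metricForm (metricCoeff h e)) (windCoord h W e) where
  smooth := by
    have h1 (i : Fin n) : ContDiffOn ℝ ∞ (lowerCoeff h W e i) e.target := contDiffOn_inner h he
      (W.contMDiff_toFun.comp_contMDiffOn (contMDiffOn_symm_of_mem_maximalAtlas he))
      (contMDiffOn_frame he _)
    exact (isMetricOn_metricCoeff h he).smooth_sharp.clm_apply
      (ContDiffOn.sum fun i _ => (h1 i).smul contDiffOn_const)
  unit x hx := by
    rw [metricForm_windCoord h W he hx, frame_windCoord h W he hx]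
    exact Real.sqrt_eq_one.1 (hW _)

end Charts

/-! ### Navigation data -/

section Navigation

variable {n : ℕ} {M : Type*} [TopologicalSpace M] [ChartedSpace (EuclideanSpace ℝ (Fin n)) M]
  [IsManifold (𝓡 n) ∞ M]
variable {F : KropinaMetric n M} {h : RiemMetric n M} {W : SmoothVectorField n M}

lemma toFun_pos (p : M) {y : TangentSpace (𝓡 n) p} (hy : y ∈ F.domain p) : 0 < F.toFun p y := by
  have hy' : 0 < F.β p y := hy
  refine div_pos (F.α.pos p y fun h0 => ?_) hy'
  rw [h0, map_zero] at hy'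
  exact lt_irrefl _ hy'

/-- Expanding the squared navigation equation, the two unit terms cancel. -/
lemma inner_eq_of_navigation (hW : IsNavigationData F h W) (p : M) {y : TangentSpace (𝓡 n) p}
    (hy : y ∈ F.domain p) : h.inner p y y = 2 * F.toFun p y * h.inner p (W p) y := by
  have hF := toFun_pos p hy
  have h1 := Real.sqrt_eq_one.1 (hW.solves p y hy)
  have h2 := Real.sqrt_eq_one.1 (hW.unit p)
  have h3 : h.inner p y (W p) = h.inner p (W p) y := h.symm p _ _
  simp only [map_sub, map_smul, sub_apply, smul_apply, smul_eq_mul, h2, h3] at h1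
  field_simp at h1
  linear_combination h1

lemma inner_wind_pos (hW : IsNavigationData F h W) (p : M) {y : TangentSpace (𝓡 n) p}
    (hy : y ∈ F.domain p) : 0 < h.inner p (W p) y := by
  have hF := toFun_pos p hy
  have hy0 : y ≠ 0 := fun h0 => by
    have hy' : 0 < F.β p y := hy
    rw [h0, map_zero] at hy'
    exact lt_irrefl _ hy'
  have h1 := h.pos p y hy0
  rw [inner_eq_of_navigation hW p hy] at h1
  exact (pos_iff_pos_of_mul_pos h1).1 (by positivity)

lemma mem_domain_iff (hW : IsNavigationData F h W) (p : M) {y : TangentSpace (𝓡 n) p} :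
    y ∈ F.domain p ↔ 0 < h.inner p (W p) y := by
  refine ⟨inner_wind_pos hW p, fun hy => ?_⟩
  obtain ⟨v, hv⟩ : ∃ v, F.β p v ≠ 0 := by
    by_contra h0
    push Not at h0
    exact F.β_ne_zero p (ContinuousLinearMap.ext h0)
  set y₀ := (F.β p v)⁻¹ • v with hy₀
  have hβ : F.β p y₀ = 1 := by simp [hy₀, hv]
  have hpos : 0 < h.inner p (W p) y₀ :=
    inner_wind_pos hW p (show 0 < F.β p y₀ by rw [hβ]; exact one_pos)
  -- If `⟨W,z⟩ ≠ 0` for some `z` in the kernel of `β`, a multiple of `z` added to `y₀` would make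
  -- `⟨W,·⟩` vanish without leaving `β > 0`. Hence `⟨W,·⟩` is a positive multiple of `β`.
  have hker (z : TangentSpace (𝓡 n) p) (hz : F.β p z = 0) : h.inner p (W p) z = 0 := by
    by_contra hne
    have h1 : 0 < h.inner p (W p) (y₀ + (-(h.inner p (W p) y₀) / h.inner p (W p) z) • z) := by
      refine inner_wind_pos hW p (show 0 < F.β p _ from ?_)
      simp [hβ, hz]
    simp only [map_add, map_smul, smul_eq_mul, div_mul_cancel₀ _ hne, add_neg_cancel,
      lt_irrefl] at h1
  have h2 := hker (y - F.β p y • y₀) (by simp [hβ])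
  simp only [map_sub, map_smul, smul_eq_mul, sub_eq_zero] at h2
  rw [h2] at hy
  exact (pos_iff_pos_of_mul_pos hy).2 hpos

variable {e : OpenPartialHomeomorph M (Rn n)} {x y : Rn n}

lemma mem_cone_iff (hW : IsNavigationData F h W) (he : e ∈ IsManifold.maximalAtlas (𝓡 n) ∞ M) :
    (x, y) ∈ cone e.target (metricForm (metricCoeff h e)) (windCoord h W e) ↔
      x ∈ e.target ∧ frame e x y ∈ F.domain (e.symm x) := by
  refine and_congr_right fun hx => ?_
  rw [mem_domain_iff hW, metricForm_windCoord h W he hx]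

lemma sqCoord_eq (hW : IsNavigationData F h W) (he : e ∈ IsManifold.maximalAtlas (𝓡 n) ∞ M)
    (hm : (x, y) ∈ cone e.target (metricForm (metricCoeff h e)) (windCoord h W e)) :
    F.sqCoord e x y = kro (metricForm (metricCoeff h e)) (windCoord h W e) x y ^ 2 := by
  obtain ⟨hx, hy⟩ := (mem_cone_iff hW he).1 hm
  have h1 := inner_wind_pos hW _ hy
  rw [KropinaMetric.sqCoord, kro, metricForm_windCoord h W he hx, metricForm_metricCoeff,
    inner_eq_of_navigation hW _ hy]
  congr 1
  field_simp

lemma hasConstantFlagCurvature_iff (hW : IsNavigationData F h W) {K : ℝ} :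
    HasConstantFlagCurvature F K ↔ ∀ e ∈ IsManifold.maximalAtlas (𝓡 n) ∞ M, ∀ x y,
      (x, y) ∈ cone e.target (metricForm (metricCoeff h e)) (windCoord h W e) → ∀ η,
      sprayCurvature (fun x y => kroSprayReg (metricForm (metricCoeff h e)) (windCoord h W e) x y
        + kroSprayProj (metricForm (metricCoeff h e)) (windCoord h W e) x y • y) η x y =
      K • (kro (metricForm (metricCoeff h e)) (windCoord h W e) x y ^ 2 • η
        - (kro (metricForm (metricCoeff h e)) (windCoord h W e) x y
          * kro1 (metricForm (metricCoeff h e)) (windCoord h W e) x y η) • y) := by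
  refine forall₂_congr fun e he => ?_
  have hH := isMetricOn_metricCoeff h he
  have hU := isUnitFieldOn_windCoord h W hW.unit he
  constructor
  · intro hC x y hm
    have hm' := (mem_cone_iff hW he).1 hm
    exact (riemannCurvature_eq_iff hH hU (fun x y => sqCoord_eq hW he) hm).1
      (hC x hm'.1 y hm'.2)
  · intro hC x hx y hy
    have hm := (mem_cone_iff hW he).2 ⟨hx, hy⟩
    exact (riemannCurvature_eq_iff hH hU (fun x y => sqCoord_eq hW he) hm).2 (hC x y hm)

lemma isUnitKilling_iff (hW : ∀ p, RiemMetric.length h p (W p) = 1) :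
    IsUnitKilling h W ↔ ∀ e ∈ IsManifold.maximalAtlas (𝓡 n) ∞ M, ∀ x ∈ e.target, ∀ u v,
      metricForm (metricCoeff h e) x (cov (metricForm (metricCoeff h e)) (windCoord h W e) x u) v =
      - metricForm (metricCoeff h e) x u
        (cov (metricForm (metricCoeff h e)) (windCoord h W e) x v) := by
  rw [IsUnitKilling, and_iff_right hW]
  refine forall₂_congr fun e he => forall₂_congr fun x hx => ?_
  have hH := isMetricOn_metricCoeff h he
  have hU := isUnitFieldOn_windCoord h W hW he
  have hc (i j : Fin n) := covDeriv_eq hH hU (w := lowerCoeff h W e)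
    (fun x hx i => (metricForm_windCoord h W he hx _).symm) hx i j
  set H := metricForm (metricCoeff h e) with hHdef
  set B := cov H (windCoord h W e) x with hB
  constructor
  · intro hk u v
    -- The symmetric part of `∇W` as a bilinear form, up to a factor: it vanishes as soon as it
    -- vanishes on coordinate vectors.
    let A : Rn n →L[ℝ] Rn n →L[ℝ] ℝ := (H x).comp B + ((H x).comp B).flip
    have hA (u v : Rn n) : A u v = H x (B u) v + H x (B v) u := rfl
    have h0 : A u v = 0 := by
      rw [← sum_apply_coordVec A u, sum_apply]
      refine Finset.sum_eq_zero fun i _ => ?_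
      rw [smul_apply, ← sum_apply_coordVec (A _) v, Finset.sum_eq_zero, smul_zero]
      intro j _
      rw [hA, ← hc, ← hc, hk, smul_zero]
    rw [hA, hH.symm x hx (B v)] at h0
    exact eq_neg_of_add_eq_zero_left h0
  · intro hk i j
    rw [hc, hc, hk, hH.symm x hx (coordVec j), neg_add_cancel]

end Navigation

end Finsler

end

/-! ### Assembly of the theorem -/

theorem corollary4p2 {n : ℕ} (hn : 2 ≤ n) {M : Type*} [TopologicalSpace M]
    [ChartedSpace (EuclideanSpace ℝ (Fin n)) M] [IsManifold (𝓡 n) ∞ M] [Nonempty M]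
    (F : Finsler.KropinaMetric n M) (hF : ¬ F.IsRiemannian)
    (h : Finsler.RiemMetric n M) (W : Finsler.SmoothVectorField n M)
    (hW : Finsler.IsNavigationData F h W) (K : ℝ) :
    Finsler.HasConstantFlagCurvature F K ↔
      Finsler.IsUnitKilling h W ∧ (0 ≤ K ∧ Finsler.HasConstantSectionalCurvature h K) := by
  rw [Finsler.hasConstantFlagCurvature_iff hW, Finsler.isUnitKilling_iff hW.unit]
  constructor
  · intro hC
    have hK : ∀ e ∈ IsManifold.maximalAtlas (𝓡 n) ∞ M, _ := fun e he =>
      Finsler.killing_of_constant_curvature (Finsler.isMetricOn_metricCoeff h he)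
        (Finsler.isUnitFieldOn_windCoord h W hW.unit he) (K := K) fun x y hm η =>
          -- The coefficient of `y` in the flag curvature condition; the Killing argument needs that
          -- condition only modulo `y`.
          ⟨-(K * (Finsler.kro (Finsler.metricForm (Finsler.metricCoeff h e))
            (Finsler.windCoord h W e) x y * Finsler.kro1
            (Finsler.metricForm (Finsler.metricCoeff h e)) (Finsler.windCoord h W e) x y η)), by
            rw [hC e he x y hm η]; module⟩
    have hR := fun e (he : e ∈ IsManifold.maximalAtlas (𝓡 n) ∞ M) x (hx : x ∈ e.target) v w =>
      Finsler.riem_of_sprayCurvature (Finsler.isMetricOn_metricCoeff h he)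
        (Finsler.isUnitFieldOn_windCoord h W hW.unit he) (hK e he) hx
        (fun y hm η => hC e he x y hm η) v w
    refine ⟨hK, ?_, fun e he x hx v w hvw => ?_⟩
    -- The sign of `K` is read off at a single point, in any chart around it.
    · obtain ⟨p⟩ := ‹Nonempty M›
      have he := IsManifold.chart_mem_maximalAtlas (I := 𝓡 n) (n := ∞) p
      have hx := mem_chart_target (Finsler.Rn n) p
      exact Finsler.curvature_nonneg (Finsler.isMetricOn_metricCoeff h he)
        (Finsler.isUnitFieldOn_windCoord h W hW.unit he) (hK _ he) hx
        (by rw [finrank_euclideanSpace_fin]; exact hn) (hR _ he _ hx)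
    · have hH := Finsler.isMetricOn_metricCoeff h he
      rw [Finsler.sectionalCurvature_eq hH hx, hR e he x hx]
      have hg := (Finsler.gram_pos hH hx hvw).ne'
      simp only [map_sub, map_smul, sub_apply, smul_apply, smul_eq_mul, hH.symm x hx w v]
      rw [div_eq_iff hg]
      ring
  · rintro ⟨hK, -, hS⟩ e he x y hm η
    have hH := Finsler.isMetricOn_metricCoeff h he
    exact Finsler.sprayCurvature_of_riem hH (Finsler.isUnitFieldOn_windCoord h W hW.unit he)
      (hK e he) hm (Finsler.riem_eq_of_sectional hH hm.1 fun v w hvw => by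
        rw [← Finsler.sectionalCurvature_eq hH hm.1]
        exact hS e he x hm.1 v w hvw) η
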